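/- Let $m\ge 1$ and $\mathrm{Pol}=\mathbb Z[x_1,x_2,\dots]$, let $\mathrm{Pol}^+$ be the polynomials without constant term, and for $i\ge1$ put $R_i f=f(x_1,\dots,x_{i-1},0,x_i,x_{i+1},\dots)$, $T^{(m)}_i=\dfrac{R_{i+1}^m-R_i^m}{x_i}$ (an exact division), and $Z^{(m)}=1+R_1^m+R_1^{2m}+\cdots:\mathrm{Pol}^+\to\mathrm{Pol}^+$. Let $\mathrm{Th}^{(m)}=\langle a_1,a_2,\dots\mid a_ia_j=a_ja_{i+m}\text{ for }i>j\rangle$ be the $m$-Thompson monoid. An indexed forest is a sequence of rooted plane trees whose internal nodes have exactly $m+1$ children, all but finitely many of the trees being a single leaf; its leaves are labelled $1,2,\dots$ from left to right. Such forests form a monoid $\mathrm{For}^{(m)}$, where in $F\cdot G$ the $i$-th leaf of $F$ is identified with the $i$-th root of $G$. Let $\underline{i}$ be the forest with a single internal node, whose leftmost leaf is $i$. If $F$ has a node all of whose children are leaves, the leftmost one being labelled $i$, then $F/i$ denotes the forest obtained by deleting that node (turning it into a leaf). $\mathrm{Trim}(F)$ is the set of sequences $(i_1,\dots,i_k)$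 for which $(((F/i_k)/i_{k-1})\cdots)/i_1$ is defined and is the empty forest $\varnothing$ (all trees trivial). **Theorem.** 1. The operators $Z^{(m)}x_i$ ($i\ge 1$) are creation operators for the $T^{(m)}_i$: they raise degrees of homogeneous polynomials by one, and $\sum_{i\ge1}Z^{(m)}x_iT^{(m)}_i=\mathrm{id}$ on $\mathrm{Pol}^+$, the sum being finite on each polynomial. 2. $(T^{(m)},\mathrm{Th}^{(m)})$ is a divided difference pair: $T^{(m)}_1$ lowers degrees by one; $T^{(m)}_i$ is $T_1^{(m)}$ acting on the variables $x_i,x_{i+1},\dots$ with $x_1,\dots,x_{i-1}$ treated as scalars; $\mathrm{Th}^{(m)}$ is graded, generated by its degree one elements, which are the distinct $a_i$, and right-cancellative ($ua_i=va_i$ implies $u=v$); and $a_i\mapsto T^{(m)}_i$ is a representation of $\mathrm{Th}^{(m)}$ on $\mathrm{Pol}$. 3. There is a monoid isomorphism $\mathrm{Th}^{(m)}\cong\mathrm{For}^{(m)}$ with $a_i\mapsto\underline i$. Under this identification there is a unique family $(P_F)_{F\in\mathrm{For}^{(m)}}$ of homogeneous polynomials (the $m$-forest polynomials) dual to this pair,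 i.e. such that $P_\varnothing=1$ and, for all $F$ and $i$, $T^{(m)}_iP_F=P_{F'}$ if $F=F'\cdot\underline i$, and $T^{(m)}_iP_F=0$ if $F$ is not of this form. 4. For every $F$ the set $\mathrm{Trim}(F)$ is finite, and $$P_F=\sum_{(i_1,\dots,i_k)\in\mathrm{Trim}(F)}Z^{(m)}x_{i_k}\cdots Z^{(m)}x_{i_1}(1).$$ Every summand, and hence $P_F$, has nonnegative coefficients. -/

import Mathlib

noncomputable section

namespace MForest

open MvPolynomial

/-!
Conventions: all indices are shifted down by one, so that `X i` (`i : ℕ`) is the variable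
`x_{i+1}`, `rope i` is `R_{i+1}`, `qdd m i` is `T^{(m)}_{i+1}`, and so on.
-/

/-- The ring `ℤ[x₁, x₂, …]`. -/
abbrev Poly : Type := MvPolynomial ℕ ℤ

/-- The polynomials with no constant term. -/
def polyPlus : Submodule ℤ Poly :=
  (RingHom.ker (constantCoeff : Poly →+* ℤ)).restrictScalars ℤ

theorem mem_polyPlus {f : Poly} : f ∈ polyPlus ↔ constantCoeff f = 0 := Iff.rfl

/-! ### Divided difference pairs, dual families, creation operators -/

/-- The shift of an endomorphism `T` of `ℤ[x₁, x₂, …]`: it acts as `id ⊗ T` on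
`ℤ[x₁, …, x_i] ⊗ ℤ[x_{i+1}, x_{i+2}, …]`, the second factor being identified with
`ℤ[x₁, x₂, …]`. -/
def shiftOp (T : Module.End ℤ Poly) (i : ℕ) : Module.End ℤ Poly :=
  let e : TensorProduct ℤ (MvPolynomial (Fin i) ℤ) Poly ≃ₐ[ℤ] Poly :=
    (tensorEquivSum ℤ (Fin i) ℕ ℤ).trans (renameEquiv ℤ (finSumNatEquiv i))
  e.toLinearMap ∘ₗ LinearMap.lTensor (MvPolynomial (Fin i) ℤ) T ∘ₗ e.symm.toLinearMap

/-- `(T, M)` is a divided difference pair, for a (total) monoid `M` with distinguished elements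
`a 0, a 1, …`: the endomorphism `T` has degree `-1`, `M` is graded and right-cancelative, its
elements of degree one are the distinct `a i`, which generate it, and `a i ↦ shiftOp T i` is a
representation of `M`. -/
structure IsDDPair {M : Type*} [Monoid M] (T : Module.End ℤ Poly) (a : ℕ → M) : Prop where
  map_const : ∀ f : Poly, f.IsHomogeneous 0 → T f = 0
  map_homogeneous : ∀ (d : ℕ) (f : Poly), f.IsHomogeneous (d + 1) → (T f).IsHomogeneous d
  graded : ∃ ℓ : M → ℕ, (∀ u v, ℓ (u * v) = ℓ u + ℓ v) ∧ (∀ w, ℓ w = 0 ↔ w = 1) ∧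
    {w | ℓ w = 1} = Set.range a
  injective : Function.Injective a
  generates : Submonoid.closure (Set.range a) = ⊤
  right_cancel : ∀ (u v : M) (i : ℕ), u * a i = v * a i → u = v
  representation : ∃ Φ : M →* Module.End ℤ Poly, ∀ i, Φ (a i) = shiftOp T i

/-- The family `S` of homogeneous polynomials is dual to `(T, M)`: `S 1 = 1`, and `T_i S_w` is
`S_{w/i}` if `w = (w/i) a_i`, and `0` if `w` has no factorization that ends in `a_i`. -/
structure IsDualFamily {M : Type*} [Monoid M] (T : Module.End ℤ Poly) (a : ℕ → M)
    (S : M → Poly) : Prop where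
  homogeneous : ∀ w, ∃ d, (S w).IsHomogeneous d
  one : S 1 = 1
  last : ∀ (w w' : M) (i : ℕ), w = w' * a i → shiftOp T i (S w) = S w'
  not_last : ∀ (w : M) (i : ℕ), (¬ ∃ w', w = w' * a i) → shiftOp T i (S w) = 0

/-- The `Y i` are creation operators for `T`: they have degree `1`, and `∑ Y_i T_i` is the
identity on polynomials without constant term (the sum being finite on each of these). -/
structure IsCreation (T : Module.End ℤ Poly) (Y : ℕ → Module.End ℤ Poly) : Prop where
  map_homogeneous : ∀ (i d : ℕ) (f : Poly), f.IsHomogeneous d → (Y i f).IsHomogeneous (d + 1)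
  finite : ∀ f ∈ polyPlus, {i | Y i (shiftOp T i f) ≠ 0}.Finite
  sum_eq : ∀ f ∈ polyPlus, ∑ᶠ i, Y i (shiftOp T i f) = f

/-! ### The operators `R_i`, `T_i^{(m)}` and `Z^{(m)}` -/

/-- The Bergeron--Sottile map
`f(x₁, x₂, …) ↦ f(x₁, …, x_{i-1}, 0, x_i, x_{i+1}, …)`, with indices shifted. -/
def rope (i : ℕ) : Poly →ₐ[ℤ] Poly :=
  aeval fun j => if j < i then X j else if j = i then 0 else X (j - 1)

theorem rope_pow_X (i n j : ℕ) : ((rope i) ^ n) (X j) =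
    if j < i then X j else if j < i + n then 0 else X (j - n) := by
  induction n generalizing j with
  | zero =>
    simp only [pow_zero, AlgHom.one_apply, add_zero, Nat.sub_zero]
    split_ifs <;> rfl
  | succ n ih =>
    rw [pow_succ, AlgHom.mul_apply]
    simp only [rope, aeval_X] at ih ⊢
    split_ifs with h1 h2 h3 h4
    · rw [ih, if_pos h1]
    · simp
    · omega
    · rw [ih, if_neg (by omega), if_pos (by omega)]
    · rw [ih, if_neg (by omega), if_neg (by omega)]
      congr 1
      omega

theorem X_dvd_rope_sub (m i : ℕ) (f : Poly) :
    X i ∣ ((rope (i + 1)) ^ m) f - ((rope i) ^ m) f := by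
  induction f using MvPolynomial.induction_on with
  | C a =>
    have h : (C a : Poly) = algebraMap ℤ Poly a := rfl
    rw [h, AlgHom.commutes, AlgHom.commutes, sub_self]
    exact dvd_zero _
  | add p q hp hq =>
    rw [map_add, map_add, add_sub_add_comm]
    exact dvd_add hp hq
  | mul_X p j hp =>
    rw [map_mul, map_mul]
    have hX : (X i : Poly) ∣ ((rope (i + 1)) ^ m) (X j) - ((rope i) ^ m) (X j) := by
      rw [rope_pow_X, rope_pow_X]
      by_cases h1 : j < i
      · simp [h1, Nat.lt_succ_of_lt h1]
      · by_cases h2 : j = i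
        · subst h2
          rcases Nat.eq_zero_or_pos m with h3 | h3
          · simp [h3]
          · simp [h3]
        · by_cases h3 : j < i + m
          · simp [h1, h3, show ¬ j < i + 1 by omega, show j < i + 1 + m by omega]
          · by_cases h4 : j = i + m
            · subst h4
              simp [show ¬ i + m < i + 1 by omega]
            · simp [h1, h3, show ¬ j < i + 1 by omega, show ¬ j < i + 1 + m by omega]
    have := dvd_add (hp.mul_right (((rope (i + 1)) ^ m) (X j)))
      (hX.mul_left (((rope i) ^ m) p))
    convert this using 1
    ring

/-- The `m`-quasisymmetric divided difference `f ↦ (R_{i+1}^m f - R_i^m f) / x_i`;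
the division is exact, see `X_mul_qdd`. -/
def qdd (m i : ℕ) : Module.End ℤ Poly :=
  AddMonoidHom.toIntLinearMap
    { toFun := fun f => (((rope (i + 1)) ^ m) f - ((rope i) ^ m) f).divMonomial
        (Finsupp.single i 1)
      map_zero' := by simp
      map_add' := fun f g => by
        rw [map_add, map_add, add_sub_add_comm, add_divMonomial] }

theorem X_mul_qdd (m i : ℕ) (f : Poly) :
    X i * qdd m i f = ((rope (i + 1)) ^ m) f - ((rope i) ^ m) f := by
  have h := divMonomial_add_modMonomial_single
    (((rope (i + 1)) ^ m) f - ((rope i) ^ m) f) i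
  rw [X_dvd_iff_modMonomial_eq_zero.mp (X_dvd_rope_sub m i f), add_zero] at h
  exact h

theorem constantCoeff_rope_pow (n : ℕ) (f : Poly) :
    constantCoeff (((rope 0) ^ n) f) = constantCoeff f := by
  have h : (constantCoeff : Poly →+* ℤ).comp ((rope 0) ^ n).toRingHom = constantCoeff := by
    apply MvPolynomial.ringHom_ext
    · intro r
      change constantCoeff (((rope 0) ^ n) (algebraMap ℤ Poly r)) = _
      rw [AlgHom.commutes]
      rfl
    · intro j
      change constantCoeff (((rope 0) ^ n) (X j)) = _
      rw [rope_pow_X]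
      split_ifs <;> simp
  exact RingHom.congr_fun h f

theorem rope_pow_eq_zero {f : Poly} (hf : f ∈ polyPlus) {n : ℕ} (hn : ∀ j ∈ f.vars, j < n) :
    ((rope 0) ^ n) f = 0 := by
  have h0 : ∀ j ∈ f.vars, (⇑((rope 0) ^ n) ∘ X) j = 0 := by
    intro j hj
    have := hn j hj
    change ((rope 0) ^ n) (X j) = 0
    rw [rope_pow_X, if_neg (by omega), if_pos (by omega)]
  have := eval₂Hom_eq_constantCoeff_of_vars (algebraMap ℤ Poly) (p := f) h0
  rw [mem_polyPlus] at hf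
  rw [hf, map_zero] at this
  rw [MvPolynomial.aeval_unique ((rope 0) ^ n)]
  exact this

theorem finite_rope_pow (m : ℕ) [NeZero m] {f : Poly} (hf : f ∈ polyPlus) :
    (Function.support fun k : ℕ => ((rope 0) ^ (m * k)) f).Finite := by
  refine (Set.finite_Iic (f.vars.sup id)).subset fun k hk => ?_
  by_contra hlt
  apply hk
  apply rope_pow_eq_zero hf
  intro j hj
  have h1 : j ≤ f.vars.sup id := Finset.le_sup (f := id) hj
  have h2 : k ≤ m * k := Nat.le_mul_of_pos_left k (NeZero.pos m)
  simp only [Set.mem_Iic, not_le] at hlt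
  omega

/-- `Z^{(m)} = 1 + R_1^m + R_1^{2m} + ⋯` on polynomials without constant term; each sum is
finite, see `finite_rope_pow`. -/
def zope (m : ℕ) [NeZero m] : polyPlus →ₗ[ℤ] polyPlus :=
  AddMonoidHom.toIntLinearMap
    { toFun := fun f => ⟨∑ᶠ k : ℕ, ((rope 0) ^ (m * k)) (f : Poly),
        finsum_induction (· ∈ polyPlus) polyPlus.zero_mem (fun _ _ => polyPlus.add_mem)
          (fun k => by rw [mem_polyPlus, constantCoeff_rope_pow]; exact f.2)⟩
      map_zero' := by simp
      map_add' := fun f g => by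
        apply Subtype.ext
        simp only [Submodule.coe_add, map_add]
        exact finsum_add_distrib (finite_rope_pow m f.2) (finite_rope_pow m g.2) }

/-- Multiplication by `x_i`, with values in the polynomials without constant term. -/
def mulX (i : ℕ) : Poly →ₗ[ℤ] polyPlus :=
  LinearMap.codRestrict polyPlus (LinearMap.mulLeft ℤ (X i : Poly)) fun f => by
    rw [mem_polyPlus]
    simp

/-- The operator `Z^{(m)} x_i`. -/
def creator (m : ℕ) [NeZero m] (i : ℕ) : Module.End ℤ Poly :=
  polyPlus.subtype ∘ₗ zope m ∘ₗ mulX i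

/-! ### The `m`-Thompson monoid -/

/-- The relations `a_i a_j = a_j a_{i+m}` for `i > j`. -/
inductive ThompsonRel (m : ℕ) : FreeMonoid ℕ → FreeMonoid ℕ → Prop
  | mk (i j : ℕ) (h : j < i) : ThompsonRel m
      (FreeMonoid.of i * FreeMonoid.of j) (FreeMonoid.of j * FreeMonoid.of (i + m))

/-- The `m`-Thompson monoid. -/
abbrev Thompson (m : ℕ) : Type := PresentedMonoid (ThompsonRel m)

/-- The generators of the `m`-Thompson monoid. -/
def Thompson.gen (m i : ℕ) : Thompson m := PresentedMonoid.of (ThompsonRel m) i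

/-! ### Indexed forests of `(m+1)`-ary trees -/

/-- Rooted plane trees in which every internal node has exactly `m + 1` children. -/
inductive MTree (m : ℕ) : Type
  | leaf : MTree m
  | node (c : Fin (m + 1) → MTree m) : MTree m

namespace MTree

/-- The number of leaves. -/
def leaves {m : ℕ} : MTree m → ℕ
  | leaf => 1
  | node c => ∑ j, (c j).leaves

/-- The number of leaves that lie below the first children, up to the `j`-th one (excluded). -/
def before {m : ℕ} (c : Fin (m + 1) → MTree m) (j : Fin (m + 1)) : ℕ :=
  ∑ j' ∈ Finset.Iio j, (c j').leaves

/-- If the leaves of `t` are labelled `k, k + 1, …` from left to right, replace the leaf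
labelled `l` by the tree `g l`, for all `l`. -/
def graft {m : ℕ} (g : ℕ → MTree m) : MTree m → ℕ → MTree m
  | leaf, k => g k
  | node c, k => node fun j => graft g (c j) (k + before c j)

/-- `Trims t i t'`: the tree `t` has a terminal node (an internal node all of whose children are
leaves) whose leftmost leaf is the `i`-th leaf of `t`, counted from `0`, and `t'` is obtained
from `t` by deleting it, which turns it into a leaf. -/
inductive Trims {m : ℕ} : MTree m → ℕ → MTree m → Prop
  | root : Trims (node fun _ => leaf) 0 leaf
  | child (c : Fin (m + 1) → MTree m) (j : Fin (m + 1)) (i : ℕ) (t : MTree m) :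
      Trims (c j) i t → Trims (node c) (before c j + i) (node (Function.update c j t))

/-- The number of leaves of the first `n` trees of a sequence. -/
def start {m : ℕ} (F : ℕ → MTree m) (n : ℕ) : ℕ := ∑ r ∈ Finset.range n, (F r).leaves

theorem leaves_pos {m : ℕ} (t : MTree m) : 0 < t.leaves := by
  induction t with
  | leaf => simp [leaves]
  | node c ih => exact Finset.sum_pos (fun j _ => ih j) Finset.univ_nonempty

theorem le_start {m : ℕ} (F : ℕ → MTree m) (n : ℕ) : n ≤ start F n := by
  induction n with
  | zero => simp
  | succ n ih =>
    have := leaves_pos (F n)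
    rw [start, Finset.sum_range_succ, ← start]
    omega

theorem start_leaf {m : ℕ} (n : ℕ) : start (fun _ => (leaf : MTree m)) n = n := by
  simp [start, leaves]

theorem start_add {m : ℕ} (F : ℕ → MTree m) (k n : ℕ) :
    start F (k + n) = start F k + start (fun r => F (k + r)) n := by
  rw [start, Finset.sum_range_add]
  rfl

/-- A sequence of trees, cut into consecutive blocks that are as long as the numbers of leaves
of the trees in `c`. -/
theorem start_sum {m : ℕ} {ι : Type*} [LinearOrder ι] (s : Finset ι) (b : ι → ℕ)
    (F : ℕ → MTree m) (k : ℕ) :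
    start F (k + ∑ j ∈ s, b j) = start F k +
      ∑ j ∈ s, start (fun r => F (k + ∑ j' ∈ s with j' < j, b j' + r)) (b j) := by
  induction s using Finset.induction_on_max with
  | empty => simp
  | insert a s hs ih =>
    have ha : a ∉ s := fun h => lt_irrefl _ (hs a h)
    rw [Finset.sum_insert ha, Finset.sum_insert ha, add_comm (b a), ← add_assoc, start_add, ih]
    have h1 : ({j' ∈ insert a s | j' < a} : Finset ι) = s := by
      ext j
      simp only [Finset.mem_filter, Finset.mem_insert]
      constructor
      · rintro ⟨rfl | h, h'⟩
        · exact absurd h' (lt_irrefl _)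
        · exact h
      · exact fun h => ⟨Or.inr h, hs j h⟩
    have h2 : ∀ j ∈ s, ({j' ∈ insert a s | j' < j} : Finset ι) = {j' ∈ s | j' < j} := by
      intro j hj
      rw [Finset.filter_insert, if_neg (not_lt.mpr (hs j hj).le)]
    rw [h1, add_assoc, add_comm (start _ (b a))]
    congr 2
    exact Finset.sum_congr rfl fun j hj => by rw [h2 j hj]

theorem leaves_graft {m : ℕ} (g : ℕ → MTree m) (t : MTree m) (k : ℕ) :
    (graft g t k).leaves = start (fun r => g (k + r)) t.leaves := by
  induction t generalizing k with
  | leaf => simp [graft, leaves, start]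
  | node c ih =>
    have h := start_sum Finset.univ (fun j => (c j).leaves) (fun r => g (k + r)) 0
    simp only [zero_add] at h
    rw [graft, leaves, leaves, h]
    simp only [start, Finset.range_zero, Finset.sum_empty, zero_add]
    refine Finset.sum_congr rfl fun j _ => ?_
    rw [ih j, start, before]
    have : (Finset.univ.filter (· < j)) = Finset.Iio j := by ext; simp
    rw [this]
    simp only [add_assoc]

theorem start_before {m : ℕ} (g : ℕ → MTree m) (c : Fin (m + 1) → MTree m) (j : Fin (m + 1))
    (k : ℕ) : start g (k + before c j) =
      start g k + before (fun j => graft g (c j) (k + before c j)) j := by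
  rw [before, start_sum, before]
  congr 1
  refine Finset.sum_congr rfl fun j' hj' => ?_
  have : (Finset.filter (· < j') (Finset.Iio j)) = Finset.Iio j' := by
    ext i
    simp only [Finset.mem_filter, Finset.mem_Iio] at hj' ⊢
    exact ⟨fun h => h.2, fun h => ⟨h.trans hj', h⟩⟩
  rw [this, leaves_graft]
  rfl

theorem graft_graft {m : ℕ} (g h : ℕ → MTree m) (t : MTree m) (k : ℕ) :
    graft h (graft g t k) (start g k) = graft (fun n => graft h (g n) (start g n)) t k := by
  induction t generalizing k with
  | leaf => rfl
  | node c ih =>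
    rw [graft, graft, graft]
    congr 1
    funext j
    rw [← start_before, ih j]

theorem graft_leaf {m : ℕ} (t : MTree m) (k : ℕ) : graft (fun _ => leaf) t k = t := by
  induction t generalizing k with
  | leaf => rfl
  | node c ih =>
    rw [graft]
    congr 1
    funext j
    exact ih j _

theorem start_graft {m : ℕ} (F g : ℕ → MTree m) (n : ℕ) :
    start (fun i => graft g (F i) (start F i)) n = start g (start F n) := by
  induction n with
  | zero => simp [start]
  | succ n ih =>
    have h : start F (n + 1) = start F n + (F n).leaves := Finset.sum_range_succ _ _
    rw [h, start_add g, ← leaves_graft, ← ih]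
    exact Finset.sum_range_succ _ _

end MTree

open MTree

/-- An indexed forest: a sequence of trees, all but finitely many of which are trivial. The leaves
are labelled `0, 1, 2, …` from left to right. -/
@[ext]
structure IndexedForest (m : ℕ) : Type where
  tree : ℕ → MTree m
  finite : {r | tree r ≠ leaf}.Finite

namespace IndexedForest

variable {m : ℕ}

/-- The empty forest. -/
instance : One (IndexedForest m) := ⟨⟨fun _ => leaf, by simp⟩⟩

/-- In the product `F * G`, the `i`-th leaf of `F` is identified with the `i`-th root of `G`. -/
instance : Mul (IndexedForest m) where
  mul F G :=
    { tree := fun r => graft G.tree (F.tree r) (start F.tree r)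
      finite := by
        obtain ⟨N, hN⟩ := G.finite.bddAbove
        refine (F.finite.union (Set.finite_Iic N)).subset fun r hr => ?_
        by_contra h
        rw [Set.mem_union, not_or] at h
        have h1 : F.tree r = leaf := not_not.mp h.1
        have h2 : G.tree (start F.tree r) = leaf := by
          by_contra h'
          exact h.2 ((le_start F.tree r).trans (hN h'))
        apply hr
        rw [h1, graft, h2] }

instance : Monoid (IndexedForest m) where
  mul_assoc F G H := IndexedForest.ext <| funext fun r => by
    change graft H.tree (graft G.tree (F.tree r) (start F.tree r))
      (start (fun i => graft G.tree (F.tree i) (start F.tree i)) r) =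
        graft (fun n => graft H.tree (G.tree n) (start G.tree n)) (F.tree r) (start F.tree r)
    rw [start_graft, graft_graft]
  one_mul F := IndexedForest.ext <| funext fun r => by
    change F.tree (start (fun _ => leaf) r) = F.tree r
    rw [start_leaf]
  mul_one F := IndexedForest.ext <| funext fun r => graft_leaf _ _

/-- The forest of size one whose only internal node has its leftmost leaf at `i`. -/
def single (m i : ℕ) : IndexedForest m where
  tree := Function.update (fun _ => leaf) i (node fun _ => leaf)
  finite := (Set.finite_singleton i).subset fun r hr => by
    by_contra h
    exact hr (Function.update_of_ne h _ _)

/-- `Trims F i F'`: the forest `F` has a terminal node whose leftmost leaf is labelled `i`, and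
`F' = F / i` is obtained from `F` by deleting it. -/
def Trims (F : IndexedForest m) (i : ℕ) (F' : IndexedForest m) : Prop :=
  ∃ (r k : ℕ) (t : MTree m), MTree.Trims (F.tree r) k t ∧ i = start F.tree r + k ∧
    F'.tree = Function.update F.tree r t

/-- `TrimSeq F [i₁, …, i_k]`: `(((F / i_k) / i_{k-1}) / ⋯) / i₁` is defined and empty. -/
inductive TrimSeq : IndexedForest m → List ℕ → Prop
  | nil : TrimSeq 1 []
  | snoc (F F' : IndexedForest m) (i : ℕ) (l : List ℕ) :
      Trims F i F' → TrimSeq F' l → TrimSeq F (l ++ [i])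

end IndexedForest

/-- The polynomial `Z^{(m)} x_{i_k} ⋯ Z^{(m)} x_{i_1} (1)` for the sequence `(i_1, …, i_k)`. -/
def creatorWord (m : ℕ) [NeZero m] (l : List ℕ) : Poly :=
  l.foldl (fun p i => creator m i p) 1

end MForest

end

noncomputable section

namespace MForest

open MvPolynomial

/-! ### The operators -/

/-! With indices from 0, write R_i, T_i, Z for `rope i`, `qdd m i`, `zope m`. The operator side
rests on telescoping. Since x_j T_j = R_{j+1}^m - R_j^m and R_N fixes f for large N, the sum of all
x_j T_j f is f - R_0^m f. On polynomials without constant term Z inverts 1 - R_0^m, which gives the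
creation identity.

The heart is a converse, `qdd_sum_creator`: if the g_j vanish for large j and T_a g_j = T_j g_{a+m}
whenever j < a, then f = ∑ Z x_j g_j has T_i f = g_i for all i. The hypothesis is the integrability
condition that `qdd_comm` forces on every family g_j = T_j f.

Let P_w be the sum of the creator words over all words for w. Grouping by last letter gives P_w = ∑
Z x_j g_j, where g_j collects the words ending in j. By induction on length the g_j are integrable,
so T_i P_w = g_i (`qdd_dualQuot`). By right cancellation g_i is P_u if w = u a_i, and it is an empty
sum if no word for w ends in i. Uniqueness holds because the creation identity recovers S_w from the
T_j S_w, and positivity because each Z x_i preserves nonnegative coefficients.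

On the monoid side every element has a sorted word. Sorted words are separated by a code on which
generators act injectively from the right (hence right cancellation), and also by their forests
(hence the isomorphism). Trimming undoes right multiplication by a one-node forest (`trims_iff`), so
the trimming sequences of a forest are exactly the words for it. -/

theorem rope_pow_comm (m : ℕ) {a b : ℕ} (h : b ≤ a) (f : Poly) :
    (rope a ^ m) ((rope b ^ m) f) = (rope b ^ m) ((rope (a + m) ^ m) f) := by
  have : (rope a ^ m).comp (rope b ^ m) = (rope b ^ m).comp (rope (a + m) ^ m) := by
    apply MvPolynomial.algHom_ext
    intro k
    simp only [AlgHom.comp_apply, rope_pow_X]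
    split_ifs <;> simp only [rope_pow_X, map_zero] <;> split_ifs <;>
      first | rfl | omega
  exact DFunLike.congr_fun this f

theorem rope_pow_eq_self {f : Poly} {n : ℕ} (hn : ∀ j ∈ f.vars, j < n) {i : ℕ} (hi : n ≤ i)
    (m : ℕ) : (rope i ^ m) f = f := by
  have h : ((rope i ^ m : Poly →ₐ[ℤ] Poly) : Poly →+* Poly) f = (RingHom.id Poly) f := by
    apply MvPolynomial.hom_congr_vars
    · apply RingHom.ext
      intro c
      exact (rope i ^ m).commutes c
    · intro j hj _
      have := hn j hj
      change (rope i ^ m) (X j) = X j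
      rw [rope_pow_X, if_pos (by omega)]
    · rfl
  exact h

theorem exists_vars_lt (f : Poly) : ∃ n, ∀ j ∈ f.vars, j < n :=
  ⟨f.vars.sup id + 1, fun _ hj => Nat.lt_succ_of_le (Finset.le_sup (f := id) hj)⟩

theorem qdd_eq_zero_of_vars (m : ℕ) {f : Poly} {n : ℕ} (hn : ∀ j ∈ f.vars, j < n) {i : ℕ}
    (hi : n ≤ i) : qdd m i f = 0 := by
  have h := X_mul_qdd m i f
  rw [rope_pow_eq_self hn hi, rope_pow_eq_self hn (by omega : n ≤ i + 1), sub_self] at h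
  exact (mul_eq_zero.mp h).resolve_left (X_ne_zero i)

theorem eq_qdd {m i : ℕ} {f g : Poly} (h : X i * g = (rope (i + 1) ^ m) f - (rope i ^ m) f) :
    qdd m i f = g :=
  mul_left_cancel₀ (X_ne_zero i) ((X_mul_qdd m i f).trans h.symm)

theorem qdd_one (m i : ℕ) : qdd m i 1 = 0 := eq_qdd (by simp)

/-- After multiplication by x_j x_i both sides are the same alternating sum of four products of two
ropes, matched by `rope_pow_comm`. The shift to i + m enters because the ropes at j and j + 1 send
x_{i+m} to x_i. -/
theorem qdd_comm (m : ℕ) {i j : ℕ} (h : j < i) (f : Poly) :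
    qdd m i (qdd m j f) = qdd m j (qdd m (i + m) f) := by
  refine eq_qdd (mul_left_cancel₀ (X_ne_zero (R := ℤ) j) ?_)
  have e1 : (X j : Poly) = (rope (i + 1) ^ m) (X j) := by rw [rope_pow_X, if_pos (by omega)]
  have e2 : (X j : Poly) = (rope i ^ m) (X j) := by rw [rope_pow_X, if_pos h]
  have e3 : (X i : Poly) = (rope (j + 1) ^ m) (X (i + m)) := by
    rw [rope_pow_X, if_neg (by omega), if_neg (by omega), Nat.add_sub_cancel]
  have e4 : (X i : Poly) = (rope j ^ m) (X (i + m)) := by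
    rw [rope_pow_X, if_neg (by omega), if_neg (by omega), Nat.add_sub_cancel]
  have l : X j * ((rope (i + 1) ^ m) (qdd m j f) - (rope i ^ m) (qdd m j f)) =
      (rope (i + 1) ^ m) (X j * qdd m j f) - (rope i ^ m) (X j * qdd m j f) := by
    rw [map_mul, map_mul, ← e1, ← e2, mul_sub]
  have r : X i * ((rope (j + 1) ^ m) (qdd m (i + m) f) - (rope j ^ m) (qdd m (i + m) f)) =
      (rope (j + 1) ^ m) (X (i + m) * qdd m (i + m) f) -
        (rope j ^ m) (X (i + m) * qdd m (i + m) f) := by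
    rw [map_mul, map_mul, ← e3, ← e4, mul_sub]
  rw [l, mul_left_comm, X_mul_qdd, r, X_mul_qdd, X_mul_qdd]
  simp only [map_sub]
  rw [rope_pow_comm m (by omega : j + 1 ≤ i + 1), rope_pow_comm m (by omega : j ≤ i + 1),
    rope_pow_comm m (by omega : j + 1 ≤ i), rope_pow_comm m (by omega : j ≤ i),
    show i + 1 + m = i + m + 1 by omega]
  ring

/-- This moves a divided difference through the terms of Z, at the cost of an index shift. -/
theorem rope_qdd (m i : ℕ) (f : Poly) :
    (rope 0 ^ m) (qdd m (i + m) f) = qdd m i ((rope 0 ^ m) f) := by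
  symm
  apply eq_qdd
  have e : (X i : Poly) = (rope 0 ^ m) (X (i + m)) := by
    rw [rope_pow_X, if_neg (by omega), if_neg (by omega), Nat.add_sub_cancel]
  rw [e, ← map_mul, X_mul_qdd, map_sub, rope_pow_comm m (by omega : 0 ≤ i + 1),
    rope_pow_comm m (by omega : 0 ≤ i), show i + 1 + m = i + m + 1 by omega]

theorem rope_pow_mul_qdd (m k i : ℕ) (f : Poly) :
    (rope 0 ^ (m * k)) (qdd m (i + m * k) f) = qdd m i ((rope 0 ^ (m * k)) f) := by
  induction k generalizing i with
  | zero => simp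
  | succ k ih =>
    have : ∀ g, (rope 0 ^ (m * (k + 1))) g = (rope 0 ^ m) ((rope 0 ^ (m * k)) g) := by
      intro g
      rw [mul_add, mul_one, add_comm, pow_add, AlgHom.mul_apply]
    rw [this, this, show i + m * (k + 1) = (i + m) + m * k by ring, ih, rope_qdd]

/-! ### Divided differences of a product with one variable -/

section mul

variable (m : ℕ) (g : Poly)

/-- The five rules of this section follow what R_{a+1}^m and R_a^m do to the variable: both fix it,
only the second kills it, both kill it, only the first kills it, both lower its index by m. -/
theorem qdd_X_mul_of_lt {a j : ℕ} (h : j < a) : qdd m a (X j * g) = X j * qdd m a g := by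
  apply eq_qdd
  rw [mul_left_comm, X_mul_qdd, map_mul, map_mul, rope_pow_X, rope_pow_X, if_pos h,
    if_pos (by omega), mul_sub]

theorem qdd_X_mul_self [NeZero m] (a : ℕ) : qdd m a (X a * g) = (rope (a + 1) ^ m) g := by
  have := NeZero.pos m
  apply eq_qdd
  rw [map_mul, map_mul, rope_pow_X, rope_pow_X, if_pos (by omega), if_neg (by omega),
    if_pos (by omega), zero_mul, sub_zero]

theorem qdd_X_mul_of_lt_of_lt {a j : ℕ} (h : a < j) (h' : j < a + m) :
    qdd m a (X j * g) = 0 := by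
  apply eq_qdd
  rw [map_mul, map_mul, rope_pow_X, rope_pow_X, if_neg (by omega), if_pos (by omega),
    if_neg (by omega), if_pos (by omega)]
  simp

theorem qdd_X_add_mul [NeZero m] (a : ℕ) : qdd m a (X (a + m) * g) = -(rope a ^ m) g := by
  have := NeZero.pos m
  apply eq_qdd
  rw [map_mul, map_mul, rope_pow_X, rope_pow_X, if_neg (by omega), if_pos (by omega),
    if_neg (by omega), if_neg (by omega), Nat.add_sub_cancel]
  ring

theorem qdd_X_mul_of_add_lt {a j : ℕ} (h : a < j) :
    qdd m a (X (j + m) * g) = X j * qdd m a g := by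
  apply eq_qdd
  rw [mul_left_comm, X_mul_qdd, map_mul, map_mul, rope_pow_X, rope_pow_X, if_neg (by omega),
    if_neg (by omega), if_neg (by omega), if_neg (by omega), Nat.add_sub_cancel, mul_sub]

end mul

theorem sum_X_mul_qdd (m a n : ℕ) (f : Poly) :
    ∑ j ∈ Finset.range n, X (a + j) * qdd m (a + j) f = (rope (a + n) ^ m) f - (rope a ^ m) f := by
  simp only [X_mul_qdd]
  exact Finset.sum_range_sub (fun j => (rope (a + j) ^ m) f) n

/-- The sum is cut at j = a and j = a + m. Integrability makes the two outer blocks telescope, and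
the terms at a and a + m cancel their inner boundary terms. -/
theorem qdd_sum_X_mul (m : ℕ) [NeZero m] (g : ℕ → Poly) {J : ℕ} (hJ : ∀ j, J ≤ j → g j = 0)
    (hg : ∀ j a, j < a → qdd m a (g j) = qdd m j (g (a + m))) (a : ℕ) :
    qdd m a (∑ j ∈ Finset.range J, X j * g j) = g a - (rope 0 ^ m) (g (a + m)) := by
  obtain ⟨N, hN⟩ := exists_vars_lt (g a)
  -- There are p indices strictly between a and a + m.
  obtain ⟨p, hp⟩ : ∃ p, m = p + 1 := ⟨m - 1, by have := NeZero.pos m; omega⟩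
  -- Padding by zero terms makes the last block reach beyond `N`, where the rope fixes g a.
  have key : ∑ j ∈ Finset.range J, X j * g j =
      ∑ j ∈ Finset.range (a + (1 + (p + (1 + (J + N))))), X j * g j := by
    apply Finset.sum_subset
    · intro x hx
      simp only [Finset.mem_range] at hx ⊢
      omega
    · intro x _ hx
      rw [hJ x (by simpa using hx), mul_zero]
  rw [key, Finset.sum_range_add, Finset.sum_range_add, Finset.sum_range_add, Finset.sum_range_add]
  simp only [map_add, map_sum, Finset.range_one, Finset.sum_singleton, add_zero]
  -- Integrability replaces T_a g_j by T_j g_{a+m}, a fixed polynomial, so the block telescopes.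
  have s1 : ∑ j ∈ Finset.range a, qdd m a (X j * g j) =
      (rope a ^ m) (g (a + m)) - (rope 0 ^ m) (g (a + m)) := by
    rw [show (rope a ^ m) (g (a + m)) = (rope (0 + a) ^ m) (g (a + m)) by rw [zero_add],
      ← sum_X_mul_qdd]
    refine Finset.sum_congr rfl fun j hj => ?_
    rw [Finset.mem_range] at hj
    rw [qdd_X_mul_of_lt m _ hj, hg j a hj, zero_add]
  have s2 : ∑ j ∈ Finset.range p, qdd m a (X (a + (1 + j)) * g (a + (1 + j))) = 0 := by
    refine Finset.sum_eq_zero fun j hj => ?_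
    rw [Finset.mem_range] at hj
    exact qdd_X_mul_of_lt_of_lt m _ (by omega) (by omega)
  -- Here integrability is used backwards: with b = a + 1 + j, T_a g_{b+m} becomes T_b g_a.
  have s3 : ∑ j ∈ Finset.range (J + N),
      qdd m a (X (a + (1 + (p + (1 + j)))) * g (a + (1 + (p + (1 + j))))) =
      g a - (rope (a + 1) ^ m) (g a) := by
    have h := sum_X_mul_qdd m (a + 1) (J + N) (g a)
    rw [rope_pow_eq_self hN (by omega : N ≤ a + 1 + (J + N)) m] at h
    rw [← h]
    refine Finset.sum_congr rfl fun j _ => ?_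
    rw [show a + (1 + (p + (1 + j))) = a + 1 + j + m by omega,
      qdd_X_mul_of_add_lt m _ (by omega), ← hg a _ (by omega)]
  rw [s1, s2, s3, qdd_X_mul_self, show a + (1 + p) = a + m by omega, qdd_X_add_mul]
  ring

/-! ### Creation operators -/

/-- Allowing every large cut-off lets later arguments enlarge it until the end of a telescoping sum
vanishes. -/
theorem zope_eq_sum (m : ℕ) [NeZero m] (f : polyPlus) :
    ∃ K₀, ∀ K, K₀ ≤ K →
      (zope m f : Poly) = ∑ k ∈ Finset.range K, (rope 0 ^ (m * k)) (f : Poly) := by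
  obtain ⟨n, hn⟩ := (finite_rope_pow m f.2).bddAbove
  refine ⟨n + 1, fun K hK => ?_⟩
  change ∑ᶠ k : ℕ, (rope 0 ^ (m * k)) (f : Poly) = _
  apply finsum_eq_sum_of_support_subset
  intro k hk
  have := hn hk
  simp only [Finset.coe_range, Set.mem_Iio]
  omega

theorem coe_mulX (i : ℕ) (f : Poly) : (mulX i f : Poly) = X i * f := rfl

theorem creator_apply (m : ℕ) [NeZero m] (i : ℕ) (f : Poly) :
    creator m i f = zope m (mulX i f) := rfl

theorem sum_creator (m : ℕ) [NeZero m] (g : ℕ → Poly) (s : Finset ℕ) :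
    ∑ j ∈ s, creator m j (g j) = zope m (∑ j ∈ s, mulX j (g j)) := by
  rw [map_sum, Submodule.coe_sum]
  rfl

/-- Moving T_i through R_0^{mk} turns it into T_{i+mk}. By `qdd_sum_X_mul` the k-th term of Z then
contributes h_k - h_{k+1} with h_k = R_0^{mk} g_{i+mk}, and only h_0 = g_i survives. -/
theorem qdd_sum_creator (m : ℕ) [NeZero m] (g : ℕ → Poly) {J : ℕ} (hJ : ∀ j, J ≤ j → g j = 0)
    (hg : ∀ j a, j < a → qdd m a (g j) = qdd m j (g (a + m))) (i : ℕ) :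
    qdd m i (∑ j ∈ Finset.range J, creator m j (g j)) = g i := by
  have hm := NeZero.pos m
  rw [sum_creator]
  obtain ⟨K₀, hK⟩ := zope_eq_sum m (∑ j ∈ Finset.range J, mulX j (g j))
  -- A cut-off of at least `J` pushes the index in the last boundary term past `J`, where g is zero.
  rw [hK (K₀ + J) (by omega), Submodule.coe_sum]
  simp only [coe_mulX]
  rw [map_sum]
  simp only [← rope_pow_mul_qdd, qdd_sum_X_mul m g hJ hg, map_sub]
  have : ∀ k, (rope 0 ^ (m * k)) ((rope 0 ^ m) (g (i + m * k + m))) =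
      (rope 0 ^ (m * (k + 1))) (g (i + m * (k + 1))) := by
    intro k
    rw [mul_add, mul_one, pow_add, AlgHom.mul_apply, add_assoc]
  simp only [this]
  rw [Finset.sum_range_sub' (fun k => (rope 0 ^ (m * k)) (g (i + m * k)))]
  have : J ≤ i + m * (K₀ + J) := by
    have := Nat.le_mul_of_pos_left (K₀ + J) hm
    omega
  rw [hJ _ this, map_zero, sub_zero]
  simp

/-- Z is the geometric series of R_0^m, hence inverts 1 - R_0^m. -/
theorem zope_sub_rope (m : ℕ) [NeZero m] (f g : polyPlus)
    (h : (g : Poly) = f - (rope 0 ^ m) (f : Poly)) : (zope m g : Poly) = f := by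
  obtain ⟨K₀, hK⟩ := zope_eq_sum m g
  obtain ⟨n, hn⟩ := exists_vars_lt (f : Poly)
  have hm := Nat.le_mul_of_pos_left (K₀ + n) (NeZero.pos m)
  rw [hK (K₀ + n) (by omega), h]
  simp only [map_sub]
  have : ∀ k, (rope 0 ^ (m * k)) ((rope 0 ^ m) (f : Poly)) = (rope 0 ^ (m * (k + 1))) (f : Poly) := by
    intro k
    rw [mul_add, mul_one, pow_add, AlgHom.mul_apply]
  simp only [this]
  have hz : (rope 0 ^ (m * (K₀ + n))) (f : Poly) = 0 :=
    rope_pow_eq_zero f.2 fun j hj => (hn j hj).trans_le ((Nat.le_add_left n K₀).trans hm)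
  rw [Finset.sum_range_sub' (fun k => (rope 0 ^ (m * k)) (f : Poly)), hz, sub_zero, mul_zero,
    pow_zero, AlgHom.one_apply]

theorem finite_creator_qdd (m : ℕ) [NeZero m] (f : Poly) :
    ∃ N, ∀ i, N ≤ i → creator m i (qdd m i f) = 0 := by
  obtain ⟨n, hn⟩ := exists_vars_lt f
  exact ⟨n, fun i hi => by rw [qdd_eq_zero_of_vars m hn hi, map_zero]⟩

theorem finsum_creator_qdd (m : ℕ) [NeZero m] {f : Poly} (hf : f ∈ polyPlus) :
    ∑ᶠ i, creator m i (qdd m i f) = f := by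
  obtain ⟨n, hn⟩ := exists_vars_lt f
  rw [finsum_eq_sum_of_support_subset (s := Finset.range n), sum_creator]
  · apply zope_sub_rope m ⟨f, hf⟩
    rw [Submodule.coe_sum]
    simp only [coe_mulX]
    have := sum_X_mul_qdd m 0 n f
    simp only [zero_add] at this
    rw [this, rope_pow_eq_self hn le_rfl]
  · intro i hi
    by_contra h
    apply hi
    simp only [Finset.coe_range, Set.mem_Iio, not_lt] at h
    change creator m i (qdd m i f) = 0
    rw [qdd_eq_zero_of_vars m hn h, map_zero]

/-! ### Homogeneity -/

theorem isHomogeneous_rope_pow (i n d : ℕ) {f : Poly} (hf : f.IsHomogeneous d) :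
    ((rope i ^ n) f).IsHomogeneous d := by
  rw [aeval_unique (rope i ^ n)]
  have := hf.aeval (⇑(rope i ^ n) ∘ X) (n := 1) (fun j => by
    change ((rope i ^ n) (X j)).IsHomogeneous 1
    rw [rope_pow_X]
    split_ifs
    · exact isHomogeneous_X _ _
    · exact isHomogeneous_zero _ _ _
    · exact isHomogeneous_X _ _)
  simpa using this

theorem isHomogeneous_of_X_mul {i d : ℕ} {f : Poly} (h : (X i * f).IsHomogeneous (d + 1)) :
    f.IsHomogeneous d := by
  intro s hs
  have h1 : (X i * f).coeff (Finsupp.single i 1 + s) ≠ 0 := by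
    rwa [coeff_X_mul]
  have := h h1
  rw [map_add, Finsupp.weight_single] at this
  simp at this
  omega

theorem isHomogeneous_qdd (m i d : ℕ) {f : Poly} (hf : f.IsHomogeneous (d + 1)) :
    (qdd m i f).IsHomogeneous d := by
  apply isHomogeneous_of_X_mul (i := i)
  rw [X_mul_qdd]
  exact (isHomogeneous_rope_pow _ _ _ hf).sub (isHomogeneous_rope_pow _ _ _ hf)

theorem qdd_const (m i : ℕ) {f : Poly} (hf : f.IsHomogeneous 0) : qdd m i f = 0 := by
  have : f.totalDegree = 0 := Nat.le_zero.mp hf.totalDegree_le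
  rw [totalDegree_eq_zero_iff_eq_C] at this
  apply eq_qdd
  rw [this]
  have h : (C (coeff 0 f) : Poly) = algebraMap ℤ Poly (coeff 0 f) := rfl
  rw [h, AlgHom.commutes, AlgHom.commutes, sub_self, mul_zero]

theorem isHomogeneous_creator (m : ℕ) [NeZero m] (i d : ℕ) {f : Poly} (hf : f.IsHomogeneous d) :
    (creator m i f).IsHomogeneous (d + 1) := by
  rw [creator_apply]
  obtain ⟨K, hK⟩ := zope_eq_sum m (mulX i f)
  rw [hK K le_rfl]
  refine IsHomogeneous.sum _ _ _ fun k _ => isHomogeneous_rope_pow _ _ _ ?_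
  rw [coe_mulX, add_comm]
  exact (isHomogeneous_X _ _).mul hf

/-! ### Nonnegativity -/

/-- The polynomials with nonnegative coefficients. -/
def nonnegPoly : Subsemiring Poly where
  carrier := {f | ∀ s, 0 ≤ f.coeff s}
  zero_mem' s := by simp
  one_mem' s := by
    rw [coeff_one]
    split_ifs <;> simp
  add_mem' hf hg s := by
    rw [coeff_add]
    exact add_nonneg (hf s) (hg s)
  mul_mem' hf hg s := by
    rw [coeff_mul]
    exact Finset.sum_nonneg fun x _ => mul_nonneg (hf _) (hg _)

theorem X_mem_nonnegPoly (i : ℕ) : (X i : Poly) ∈ nonnegPoly := by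
  intro s
  rw [coeff_X]
  split_ifs <;> simp

theorem C_mem_nonnegPoly {c : ℤ} (hc : 0 ≤ c) : (C c : Poly) ∈ nonnegPoly := by
  intro s
  rw [coeff_C]
  split_ifs <;> simp [hc]

/-- A rope substitutes a variable or 0 for each variable. -/
theorem rope_pow_mem_nonnegPoly (i n : ℕ) {f : Poly} (hf : f ∈ nonnegPoly) :
    (rope i ^ n) f ∈ nonnegPoly := by
  rw [aeval_unique (rope i ^ n), aeval_def, eval₂_eq]
  refine Subsemiring.sum_mem _ fun s _ => Subsemiring.mul_mem _ (C_mem_nonnegPoly (hf s)) ?_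
  refine Subsemiring.prod_mem _ fun j _ => Subsemiring.pow_mem _ ?_ _
  change (rope i ^ n) (X j) ∈ nonnegPoly
  rw [rope_pow_X]
  split_ifs
  · exact X_mem_nonnegPoly _
  · exact Subsemiring.zero_mem _
  · exact X_mem_nonnegPoly _

theorem creator_mem_nonnegPoly (m : ℕ) [NeZero m] (i : ℕ) {f : Poly} (hf : f ∈ nonnegPoly) :
    creator m i f ∈ nonnegPoly := by
  rw [creator_apply]
  obtain ⟨K, hK⟩ := zope_eq_sum m (mulX i f)
  rw [hK K le_rfl]
  exact Subsemiring.sum_mem _ fun k _ => rope_pow_mem_nonnegPoly _ _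
    (Subsemiring.mul_mem _ (X_mem_nonnegPoly i) hf)

theorem creatorWord_append (m : ℕ) [NeZero m] (l : List ℕ) (i : ℕ) :
    creatorWord m (l ++ [i]) = creator m i (creatorWord m l) := by
  simp [creatorWord, List.foldl_append]

theorem creatorWord_mem_nonnegPoly (m : ℕ) [NeZero m] (l : List ℕ) :
    creatorWord m l ∈ nonnegPoly := by
  induction l using List.reverseRecOn with
  | nil => exact Subsemiring.one_mem _
  | append_singleton l i ih =>
    rw [creatorWord_append]
    exact creator_mem_nonnegPoly m i ih

theorem isHomogeneous_creatorWord (m : ℕ) [NeZero m] (l : List ℕ) :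
    (creatorWord m l).IsHomogeneous l.length := by
  induction l using List.reverseRecOn with
  | nil => exact isHomogeneous_one _ _
  | append_singleton l i ih =>
    rw [creatorWord_append, List.length_append]
    exact isHomogeneous_creator m i _ ih

/-! ### Shifts -/

/-- Powers of `rope (i + k)` fix the first i variables and act on the others as those of `rope k`.
So on a pure tensor the left factor comes out of the quotient. -/
theorem shiftOp_qdd (m i : ℕ) : shiftOp (qdd m 0) i = qdd m i := by
  let e : TensorProduct ℤ (MvPolynomial (Fin i) ℤ) Poly ≃ₐ[ℤ] Poly :=
    (tensorEquivSum ℤ (Fin i) ℕ ℤ).trans (renameEquiv ℤ (finSumNatEquiv i))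
  have he : ∀ f g, e (f ⊗ₜ g) = rename (fun j : Fin i => (j : ℕ)) f * rename (fun j => i + j) g := by
    intro f g
    have h1 : e (f ⊗ₜ[ℤ] 1) = rename (fun j : Fin i => (j : ℕ)) f := by
      have : e.toAlgHom.comp Algebra.TensorProduct.includeLeft =
          rename (fun j : Fin i => (j : ℕ)) := by
        apply MvPolynomial.algHom_ext
        intro j
        simp [e]
      exact DFunLike.congr_fun this f
    have h2 : e (1 ⊗ₜ[ℤ] g) = rename (fun j => i + j) g := by
      have : e.toAlgHom.comp Algebra.TensorProduct.includeRight =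
          rename (fun j => i + j) := by
        apply MvPolynomial.algHom_ext
        intro j
        simp [e]
      exact DFunLike.congr_fun this g
    rw [← h1, ← h2, ← map_mul, Algebra.TensorProduct.tmul_mul_tmul, mul_one, one_mul]
  have hleft : ∀ (k n : ℕ) (f : MvPolynomial (Fin i) ℤ), i ≤ k →
      (rope k ^ n) (rename (fun j : Fin i => (j : ℕ)) f) = rename (fun j : Fin i => (j : ℕ)) f := by
    intro k n f hk
    have : (rope k ^ n).comp (rename (fun j : Fin i => (j : ℕ))) =
        rename (fun j : Fin i => (j : ℕ)) := by
      apply MvPolynomial.algHom_ext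
      intro j
      have := j.2
      rw [AlgHom.comp_apply, rename_X, rope_pow_X, if_pos (by omega)]
    exact DFunLike.congr_fun this f
  have hright : ∀ (k n : ℕ) (g : Poly),
      (rope (i + k) ^ n) (rename (fun j => i + j) g) = rename (fun j => i + j) ((rope k ^ n) g) := by
    intro k n g
    have : (rope (i + k) ^ n).comp (rename (fun j => i + j)) =
        (rename (fun j => i + j)).comp (rope k ^ n) := by
      apply MvPolynomial.algHom_ext
      intro j
      rw [AlgHom.comp_apply, AlgHom.comp_apply, rename_X, rope_pow_X, rope_pow_X]
      split_ifs <;> first | omega | simp only [rename_X, map_zero]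
      congr 1
      omega
    exact DFunLike.congr_fun this g
  have key : e.toLinearMap ∘ₗ LinearMap.lTensor (MvPolynomial (Fin i) ℤ) (qdd m 0) =
      qdd m i ∘ₗ e.toLinearMap := by
    apply TensorProduct.ext'
    intro f g
    simp only [LinearMap.comp_apply, LinearMap.lTensor_tmul, AlgEquiv.toLinearMap_apply, he]
    symm
    apply eq_qdd
    rw [map_mul, map_mul, hleft _ _ _ le_rfl, hleft _ _ _ (Nat.le_succ i), hright 1,
      show rope i = rope (i + 0) from rfl, hright 0, mul_left_comm, ← mul_sub, ← map_sub,
      ← zero_add 1, ← X_mul_qdd, map_mul, rename_X, add_zero]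
  apply LinearMap.ext
  intro f
  have := LinearMap.congr_fun key (e.symm f)
  simp only [LinearMap.comp_apply, AlgEquiv.toLinearMap_apply, AlgEquiv.apply_symm_apply] at this
  exact this

/-! ### The Thompson monoid -/

namespace Thompson

variable {m : ℕ}

theorem gen_mul_gen {i j : ℕ} (h : j < i) : gen m i * gen m j = gen m j * gen m (i + m) :=
  PresentedMonoid.mk_eq_mk_of_rel (ThompsonRel.mk i j h)

/-- The product of the generators given by a list of indices. -/
def word (m : ℕ) (l : List ℕ) : Thompson m := (l.map (gen m)).prod

@[simp] theorem word_nil : word m [] = 1 := rfl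

@[simp] theorem word_cons (i : ℕ) (l : List ℕ) : word m (i :: l) = gen m i * word m l := by
  simp [word]

@[simp] theorem word_append (l l' : List ℕ) : word m (l ++ l') = word m l * word m l' := by
  simp [word]

theorem word_singleton (i : ℕ) : word m [i] = gen m i := by simp

theorem exists_word (w : Thompson m) : ∃ l, word m l = w := by
  induction w using PresentedMonoid.inductionOn with
  | h a =>
    refine ⟨FreeMonoid.toList a, ?_⟩
    induction a using FreeMonoid.inductionOn' with
    | one => rfl
    | of_mul i a ih =>
      rw [FreeMonoid.toList_mul, FreeMonoid.toList_of, List.singleton_append, word_cons, ih, map_mul]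
      rfl

theorem closure_range_gen : Submonoid.closure (Set.range (gen m)) = ⊤ :=
  PresentedMonoid.closure_range_of _

/-- A map that respects the defining relations extends to the Thompson monoid. -/
def lift {M : Type*} [Monoid M] (f : ℕ → M) (h : ∀ i j, j < i → f i * f j = f j * f (i + m)) :
    Thompson m →* M :=
  PresentedMonoid.lift f (by
    rintro _ _ ⟨i, j, hij⟩
    simpa using h i j hij)

theorem lift_gen {M : Type*} [Monoid M] (f : ℕ → M)
    (h : ∀ i j, j < i → f i * f j = f j * f (i + m)) (i : ℕ) : lift f h (gen m i) = f i := rfl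

theorem map_word {M : Type*} [Monoid M] (φ : Thompson m →* M) (l : List ℕ) :
    φ (word m l) = (l.map fun i => φ (gen m i)).prod := by
  rw [word, map_list_prod, List.map_map]
  rfl

/-! ### Grading, and finiteness of the set of words -/

/-- The length of an element. -/
def length (w : Thompson m) : ℕ :=
  Multiplicative.toAdd (lift (m := m) (fun _ => Multiplicative.ofAdd 1) (fun _ _ _ => rfl) w)

theorem length_mul (u v : Thompson m) : length (u * v) = length u + length v := by
  simp [length]

theorem length_one : length (1 : Thompson m) = 0 := by simp [length]

theorem length_gen (i : ℕ) : length (gen m i) = 1 := rfl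

theorem length_word (l : List ℕ) : length (word m l) = l.length := by
  induction l with
  | nil => exact length_one
  | cons i l ih => rw [word_cons, length_mul, length_gen, ih, List.length_cons, add_comm]

theorem length_eq_zero {w : Thompson m} : length w = 0 ↔ w = 1 := by
  obtain ⟨l, rfl⟩ := exists_word w
  constructor
  · intro h
    rw [length_word, List.length_eq_zero_iff] at h
    rw [h, word_nil]
  · intro h
    rw [h, length_one]

theorem length_eq_one {w : Thompson m} : length w = 1 ↔ w ∈ Set.range (gen m) := by
  constructor
  · intro h
    obtain ⟨l, rfl⟩ := exists_word w
    rw [length_word, List.length_eq_one_iff] at h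
    obtain ⟨i, rfl⟩ := h
    exact ⟨i, (word_singleton i).symm⟩
  · rintro ⟨i, rfl⟩
    exact length_gen i

/-- A bound for the letters of the words for an element. -/
def bound (w : Thompson m) : ℕ :=
  -- Moving past a smaller letter raises a letter by m, so each earlier letter is allowed a raise by
  -- m for every later one. The opposite monoid makes this a right action.
  (MulOpposite.unop (lift (m := m) (M := (Function.End ℕ)ᵐᵒᵖ)
    (fun i => MulOpposite.op fun x => max (x + m) i) (by
      intro i j h
      refine MulOpposite.unop_injective (funext fun x => ?_)
      change max (max (x + m) i + m) j = max (max (x + m) j + m) (i + m)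
      omega) w) : Function.End ℕ) 0

theorem bound_mul_gen (w : Thompson m) (i : ℕ) : bound (w * gen m i) = max (bound w + m) i := by
  rw [bound, map_mul, lift_gen]
  rfl

theorem word_mem_le (l : List ℕ) : ∀ i ∈ l, i ≤ bound (word m l) := by
  induction l using List.reverseRecOn with
  | nil => simp
  | append_singleton l j ih =>
    intro i hi
    rw [word_append, word_singleton, bound_mul_gen]
    rw [List.mem_append, List.mem_singleton] at hi
    rcases hi with hi | rfl
    · have := ih i hi
      omega
    · exact le_max_right _ _

/-- All words for w have the same length and letters bounded in terms of w. -/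
theorem finite_words (w : Thompson m) : {l | word m l = w}.Finite := by
  refine ((List.finite_length_eq (Fin (bound w + 1)) (length w)).image
    (List.map fun x : Fin (bound w + 1) => (x : ℕ))).subset ?_
  rintro l rfl
  have h : ∀ i ∈ l, i < bound (word m l) + 1 := fun i hi => Nat.lt_succ_of_le (word_mem_le l i hi)
  refine ⟨l.pmap Fin.mk h, ?_, ?_⟩
  · simp [length_word]
  · simp [List.map_pmap]

/-! ### Sorted words and codes -/

/-- Every word can be sorted. -/
theorem exists_sorted_gen_mul (l : List ℕ) (hl : l.Pairwise (· ≤ ·)) (i : ℕ) :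
    ∃ l' : List ℕ, l'.Pairwise (· ≤ ·) ∧ (∀ b, b ≤ i → (∀ x ∈ l, b ≤ x) → ∀ x ∈ l', b ≤ x) ∧
      word m l' = gen m i * word m l := by
  induction l generalizing i with
  | nil => exact ⟨[i], by simp, by simp, by simp⟩
  | cons j l ih =>
    rw [List.pairwise_cons] at hl
    by_cases h : i ≤ j
    · refine ⟨i :: j :: l, ?_, ?_, by simp⟩
      · rw [List.pairwise_cons, List.pairwise_cons]
        refine ⟨fun x hx => ?_, hl⟩
        rcases List.mem_cons.mp hx with rfl | hx
        · exact h
        · exact h.trans (hl.1 x hx)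
      · intro b hb hb' x hx
        rcases List.mem_cons.mp hx with rfl | hx
        · exact hb
        · exact hb' x hx
    -- The letter i crosses the smaller j and becomes i + m. The clause on lower bounds, applied to
    -- j, keeps j in front.
    · obtain ⟨l', h1, h2, h3⟩ := ih hl.2 (i + m)
      refine ⟨j :: l', ?_, ?_, ?_⟩
      · rw [List.pairwise_cons]
        exact ⟨h2 j (by omega) hl.1, h1⟩
      · intro b hb hb' x hx
        rcases List.mem_cons.mp hx with rfl | hx
        · exact hb' _ List.mem_cons_self
        · exact h2 b (by omega) (fun y hy => hb' y (List.mem_cons_of_mem _ hy)) x hx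
      · rw [word_cons, h3, word_cons, ← mul_assoc, ← mul_assoc, gen_mul_gen (by omega : j < i)]

theorem exists_sorted_word (w : Thompson m) :
    ∃ l : List ℕ, l.Pairwise (· ≤ ·) ∧ word m l = w := by
  obtain ⟨l, rfl⟩ := exists_word w
  induction l with
  | nil => exact ⟨[], List.Pairwise.nil, rfl⟩
  | cons i l ih =>
    obtain ⟨l', h, h'⟩ := ih
    obtain ⟨l'', h1, -, h2⟩ := exists_sorted_gen_mul (m := m) l' h i
    exact ⟨l'', h1, by rw [h2, h', word_cons]⟩

/-- The action of the `i`-th generator on codes: the `i`-th entry is incremented, and `m` zeros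
are inserted after it. -/
def codeStep (m i : ℕ) (c : ℕ → ℕ) : ℕ → ℕ := fun l =>
  if l < i then c l else if l = i then c i + 1 else if l ≤ i + m then 0 else c (l - m)

theorem codeStep_injective (i : ℕ) : Function.Injective (codeStep m i) := by
  intro c d h
  funext l
  rcases lt_trichotomy l i with hl | rfl | hl
  · simpa [codeStep, hl] using congrFun h l
  · simpa [codeStep] using congrFun h l
  · have := congrFun h (l + m)
    simpa [codeStep, show ¬ l + m < i by omega, show ¬ l + m = i by omega,
      show ¬ l ≤ i by omega] using this

/-- The code of an element. -/
def code (w : Thompson m) : ℕ → ℕ :=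
  (MulOpposite.unop (lift (m := m) (M := (Function.End (ℕ → ℕ))ᵐᵒᵖ)
    (fun i => MulOpposite.op (codeStep m i)) (by
      intro i j h
      refine MulOpposite.unop_injective (funext fun c => funext fun l => ?_)
      change codeStep m j (codeStep m i c) l = codeStep m (i + m) (codeStep m j c) l
      simp only [codeStep]
      split_ifs <;> first | rfl | omega | (congr 1; omega) | (congr 2; omega)) w) :
    Function.End (ℕ → ℕ)) fun _ => 0

theorem code_mul_gen (w : Thompson m) (i : ℕ) : code (w * gen m i) = codeStep m i (code w) := by
  rw [code, map_mul, lift_gen]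
  rfl

/-- The last letter of a sorted word is its largest, so the zeros that it inserts only displace
zeros and one count goes up. -/
theorem code_word (l : List ℕ) (hl : l.Pairwise (· ≤ ·)) (x : ℕ) :
    code (word m l) x = l.count x := by
  induction l using List.reverseRecOn generalizing x with
  | nil => rfl
  | append_singleton l i ih =>
    rw [List.pairwise_append] at hl
    have h : ∀ y, i < y → l.count y = 0 := fun y hy => List.count_eq_zero.mpr fun hm => by
      have := hl.2.2 y hm i (by simp)
      omega
    rw [word_append, word_singleton, code_mul_gen, List.count_append, List.count_singleton]
    simp only [codeStep, ih hl.1]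
    rcases lt_trichotomy x i with h1 | rfl | h1
    · simp [h1, h1.ne']
    · simp
    · rw [if_neg (by omega), if_neg (by omega), h x h1]
      split_ifs with h2 h3 h3
      · simp at h3; omega
      · rfl
      · simp at h3; omega
      · rw [h _ (by omega)]

/-- A sorted word is determined by the multiplicities of its letters. -/
theorem code_injective : Function.Injective (code : Thompson m → ℕ → ℕ) := by
  intro u v h
  obtain ⟨l, hl, rfl⟩ := exists_sorted_word u
  obtain ⟨l', hl', rfl⟩ := exists_sorted_word v
  have : l.Perm l' := List.perm_iff_count.mpr fun x => by
    rw [← code_word (m := m) l hl, h, code_word l' hl']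
  rw [this.eq_of_pairwise (fun a b _ _ => le_antisymm) hl hl']

theorem mul_gen_right_cancel {u v : Thompson m} {i : ℕ} (h : u * gen m i = v * gen m i) : u = v :=
  code_injective (codeStep_injective i (by rw [← code_mul_gen, ← code_mul_gen, h]))

theorem gen_injective : Function.Injective (gen m) := by
  intro i j h
  have h1 := code_word (m := m) [i] (by simp) i
  rw [word_singleton, h, ← word_singleton, code_word _ (by simp)] at h1
  by_contra hne
  simp [Ne.symm hne] at h1

end Thompson

theorem isDDPair (m : ℕ) : IsDDPair (qdd m 0) (Thompson.gen m) where
  map_const _ hf := qdd_const m 0 hf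
  map_homogeneous d _ hf := isHomogeneous_qdd m 0 d hf
  graded := ⟨Thompson.length, Thompson.length_mul, fun _ => Thompson.length_eq_zero,
    Set.ext fun _ => Thompson.length_eq_one⟩
  injective := Thompson.gen_injective
  generates := Thompson.closure_range_gen
  right_cancel _ _ _ h := Thompson.mul_gen_right_cancel h
  representation := ⟨Thompson.lift (qdd m) fun _ _ h => LinearMap.ext fun f => qdd_comm m h f,
    fun i => by rw [Thompson.lift_gen, shiftOp_qdd]⟩

theorem isCreation (m : ℕ) [NeZero m] : IsCreation (qdd m 0) (creator m) where
  map_homogeneous i d _ hf := isHomogeneous_creator m i d hf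
  finite f _ := by
    obtain ⟨N, hN⟩ := finite_creator_qdd m f
    refine (Set.finite_Iio N).subset fun i hi => ?_
    by_contra h
    apply hi
    rw [shiftOp_qdd]
    exact hN i (by simpa using h)
  sum_eq f hf := by
    simp only [shiftOp_qdd]
    exact finsum_creator_qdd m hf

/-! ### The dual family -/

namespace Thompson

variable {m : ℕ} [NeZero m]

/-- The sum of the creator words of the words for `w` that end in `r`, with `r` removed. -/
def dualQuot (w : Thompson m) (r : List ℕ) : Poly :=
  ∑ᶠ l ∈ {l | word m (l ++ r) = w}, creatorWord m l

omit [NeZero m] in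
theorem finite_words_append (w : Thompson m) (r : List ℕ) : {l | word m (l ++ r) = w}.Finite :=
  Set.Finite.preimage (List.append_left_injective r).injOn (finite_words w)

/-- By right cancellation the two sums run over the same words. -/
theorem dualQuot_mul_gen (u : Thompson m) (r : List ℕ) (i : ℕ) :
    dualQuot (u * gen m i) (r ++ [i]) = dualQuot u r := by
  have : {l | word m (l ++ (r ++ [i])) = u * gen m i} = {l | word m (l ++ r) = u} := by
    ext l
    simp only [Set.mem_ofPred_eq, ← List.append_assoc]
    rw [word_append _ [i], word_singleton]
    exact ⟨mul_gen_right_cancel, fun h => by rw [h]⟩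
  rw [dualQuot, this, dualQuot]

theorem dualQuot_eq_zero {w : Thompson m} {i : ℕ} (h : ¬ ∃ u, w = u * gen m i) (r : List ℕ) :
    dualQuot w (r ++ [i]) = 0 := by
  have : {l | word m (l ++ (r ++ [i])) = w} = ∅ := by
    ext l
    simp only [Set.mem_ofPred_eq, Set.mem_empty_iff_false, iff_false]
    rintro rfl
    exact h ⟨word m (l ++ r), by rw [← List.append_assoc, word_append _ [i], word_singleton]⟩
  rw [dualQuot, this, finsum_mem_empty]

theorem dualQuot_eq_zero_of_bound_lt {w : Thompson m} {i : ℕ} (h : bound w < i) :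
    dualQuot w [i] = 0 := by
  refine dualQuot_eq_zero (r := []) ?_
  rintro ⟨u, rfl⟩
  rw [bound_mul_gen] at h
  omega

/-- Nonempty words are grouped by their last letter, which is at most `bound w`. -/
theorem dualQuot_eq_sum {w : Thompson m} (hw : w ≠ 1) {N : ℕ} (hN : bound w < N) :
    dualQuot w [] = ∑ i ∈ Finset.range N, creator m i (dualQuot w [i]) := by
  have h1 : ∀ i, creator m i (dualQuot w [i]) =
      ∑ l ∈ (finite_words_append w [i]).toFinset, creatorWord m (l ++ [i]) := by
    intro i
    rw [dualQuot, finsum_mem_eq_finite_toFinset_sum _ (finite_words_append w [i]), map_sum]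
    simp only [creatorWord_append]
  simp only [h1]
  rw [dualQuot, finsum_mem_eq_finite_toFinset_sum _ (finite_words_append w []),
    Finset.sum_sigma']
  symm
  refine Finset.sum_bij (fun p _ => p.2 ++ [p.1]) ?_ ?_ ?_ ?_
  · rintro ⟨i, l⟩ h
    rw [Finset.mem_sigma, Set.Finite.mem_toFinset] at h
    rw [Set.Finite.mem_toFinset, Set.mem_ofPred_eq, List.append_nil]
    exact h.2
  · rintro ⟨i, l⟩ - ⟨j, l'⟩ - h
    obtain ⟨rfl, h'⟩ := List.append_inj' h rfl
    simp only [List.cons.injEq, and_true] at h'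
    rw [h']
  · intro l hl
    simp only [List.append_nil, Set.Finite.mem_toFinset, Set.mem_ofPred_eq] at hl
    rcases List.eq_nil_or_concat l with rfl | ⟨l', i, rfl⟩
    · exact absurd hl.symm hw
    · rw [List.concat_eq_append] at hl ⊢
      refine ⟨⟨i, l'⟩, ?_, rfl⟩
      have := word_mem_le (m := m) (l' ++ [i]) i (by simp)
      rw [hl] at this
      rw [Finset.mem_sigma, Finset.mem_range, Set.Finite.mem_toFinset]
      exact ⟨this.trans_lt hN, hl⟩
  · intros
    rfl

theorem dualQuot_swap (w : Thompson m) {i j : ℕ} (h : j < i) :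
    dualQuot w [i, j] = dualQuot w [j, i + m] := by
  have : word m [i, j] = word m [j, i + m] := by simpa using gen_mul_gen h
  simp only [dualQuot, word_append, this]

theorem dualQuot_one : dualQuot (1 : Thompson m) [] = 1 := by
  have : {l | word m (l ++ []) = 1} = {[]} := by
    ext l
    rw [Set.mem_ofPred_eq, List.append_nil, ← length_eq_zero, length_word,
      List.length_eq_zero_iff, Set.mem_singleton_iff]
  rw [dualQuot, this, finsum_mem_singleton]
  rfl

theorem qdd_dualQuot (w : Thompson m) (i : ℕ) : qdd m i (dualQuot w []) = dualQuot w [i] := by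
  induction h : length w generalizing w i with
  | zero =>
    rw [length_eq_zero] at h
    subst h
    rw [dualQuot_one, qdd_one]
    symm
    refine dualQuot_eq_zero (r := []) ?_
    rintro ⟨u, hu⟩
    have := congrArg length hu
    rw [length_one, length_mul, length_gen] at this
    omega
  | succ n ih =>
    have hw : w ≠ 1 := by
      rintro rfl
      rw [length_one] at h
      omega
    -- The sum for [j] is zero or belongs to a shorter element, so the induction hypothesis applies.
    -- Integrability then says that the words [a, j] and [j, a + m] are equal in the monoid.
    have key : ∀ j a, qdd m a (dualQuot w [j]) = dualQuot w [a, j] := by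
      intro j a
      by_cases hj : ∃ u, w = u * gen m j
      · obtain ⟨u, rfl⟩ := hj
        rw [length_mul, length_gen] at h
        have e1 : dualQuot (u * gen m j) [j] = dualQuot u [] := dualQuot_mul_gen u [] j
        have e2 : dualQuot (u * gen m j) [a, j] = dualQuot u [a] := dualQuot_mul_gen u [a] j
        rw [e1, e2, ih u a (by omega)]
      · have e1 : dualQuot w [j] = 0 := dualQuot_eq_zero hj []
        have e2 : dualQuot w [a, j] = 0 := dualQuot_eq_zero hj [a]
        rw [e1, e2, map_zero]
    rw [dualQuot_eq_sum hw (Nat.lt_succ_self _)]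
    refine qdd_sum_creator m (fun j => dualQuot w [j]) (fun j hj => ?_) (fun j a hja => ?_) i
    · exact dualQuot_eq_zero_of_bound_lt hj
    · rw [key, key, dualQuot_swap w hja]

theorem isDualFamily_dualQuot :
    IsDualFamily (qdd m 0) (gen m) fun w : Thompson m => dualQuot w [] where
  homogeneous w := by
    refine ⟨length w, ?_⟩
    rw [dualQuot, finsum_mem_eq_finite_toFinset_sum _ (finite_words_append w [])]
    refine IsHomogeneous.sum _ _ _ fun l hl => ?_
    simp only [List.append_nil, Set.Finite.mem_toFinset, Set.mem_ofPred_eq] at hl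
    rw [← hl, length_word]
    exact isHomogeneous_creatorWord m l
  one := dualQuot_one
  last w w' i h := by
    rw [shiftOp_qdd, qdd_dualQuot, h]
    exact dualQuot_mul_gen w' [] i
  not_last w i h := by
    rw [shiftOp_qdd, qdd_dualQuot]
    exact dualQuot_eq_zero h []

/-- Dual families are unique. -/
theorem eq_of_isDualFamily {S S' : Thompson m → Poly} (h : IsDualFamily (qdd m 0) (gen m) S)
    (h' : IsDualFamily (qdd m 0) (gen m) S') (w : Thompson m) : S w = S' w := by
  -- Successive divided differences along a word lead from S_w down to 1.
  have hne : ∀ S : Thompson m → Poly, IsDualFamily (qdd m 0) (gen m) S → ∀ w, S w ≠ 0 := by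
    intro S h w
    obtain ⟨l, rfl⟩ := exists_word w
    induction l using List.reverseRecOn with
    | nil =>
      rw [word_nil, h.one]
      exact one_ne_zero
    | append_singleton l i ih =>
      intro h0
      have := h.last _ _ i (word_append l [i])
      rw [h0, map_zero] at this
      exact ih this.symm
  -- In degree 0 the polynomial would be killed by T_i, but its image is the nonzero S_u. Positive
  -- degree excludes a constant term.
  have hplus : ∀ S : Thompson m → Poly, IsDualFamily (qdd m 0) (gen m) S →
      ∀ u i, S (u * gen m i) ∈ polyPlus := by
    intro S h u i
    obtain ⟨d, hd⟩ := h.homogeneous (u * gen m i)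
    have hd0 : d ≠ 0 := by
      rintro rfl
      have := h.last _ u i rfl
      rw [shiftOp_qdd, qdd_const m i hd] at this
      exact hne S h u this.symm
    rw [mem_polyPlus]
    by_contra hc
    have := hd hc
    simp only [map_zero] at this
    exact hd0 this.symm
  induction hl : length w using Nat.strong_induction_on generalizing w with
  | _ n ih =>
    obtain ⟨l, hw⟩ := exists_word w
    rcases List.eq_nil_or_concat l with rfl | ⟨l', i, rfl⟩
    · rw [word_nil] at hw
      rw [← hw, h.one, h'.one]
    · rw [List.concat_eq_append, word_append, word_singleton] at hw
      have e1 := (isCreation m).sum_eq _ (hplus S h (word m l') i)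
      have e2 := (isCreation m).sum_eq _ (hplus S' h' (word m l') i)
      rw [hw] at e1 e2
      rw [← e1, ← e2]
      refine finsum_congr fun j => congrArg _ ?_
      by_cases hj : ∃ u, w = u * gen m j
      · obtain ⟨u, hu⟩ := hj
        rw [h.last _ _ _ hu, h'.last _ _ _ hu]
        refine ih (length u) ?_ u rfl
        rw [← hl, hu, length_mul, length_gen]
        omega
      · rw [h.not_last _ _ hj, h'.not_last _ _ hj]

end Thompson

open MTree

/-! ### Forests -/

namespace MTree

variable {m : ℕ}

theorem before_add_leaves_le (c : Fin (m + 1) → MTree m) {j j' : Fin (m + 1)} (h : j < j') :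
    before c j + (c j).leaves ≤ before c j' := by
  rw [before, add_comm, ← Finset.sum_insert (f := fun j => (c j).leaves) (by simp)]
  refine Finset.sum_le_sum_of_subset fun x hx => ?_
  rw [Finset.mem_insert, Finset.mem_Iio] at hx
  rw [Finset.mem_Iio]
  rcases hx with rfl | hx
  · exact h
  · exact hx.trans h

theorem before_add_leaves_le_leaves (c : Fin (m + 1) → MTree m) (j : Fin (m + 1)) :
    before c j + (c j).leaves ≤ (node c).leaves := by
  rw [before, add_comm, ← Finset.sum_insert (f := fun j => (c j).leaves) (by simp), leaves]
  exact Finset.sum_le_sum_of_subset (Finset.subset_univ _)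

theorem before_update (c : Fin (m + 1) → MTree m) {j j' : Fin (m + 1)} (h : j' ≤ j)
    (t : MTree m) : before (Function.update c j t) j' = before c j' := by
  refine Finset.sum_congr rfl fun x hx => ?_
  rw [Finset.mem_Iio] at hx
  rw [Function.update_of_ne (hx.trans_le h).ne]

theorem before_zero (c : Fin (m + 1) → MTree m) : before c 0 = 0 := by
  refine Finset.sum_eq_zero fun x hx => ?_
  simp at hx

/-- The child that contains leaf p is the last one that starts at or before p. -/
theorem exists_before_le_lt (c : Fin (m + 1) → MTree m) {p : ℕ} (hp : p < (node c).leaves) :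
    ∃ j, before c j ≤ p ∧ p < before c j + (c j).leaves := by
  have hne : (Finset.univ.filter fun j => before c j ≤ p).Nonempty :=
    ⟨0, by simp [before_zero]⟩
  obtain ⟨j, hj, hmax⟩ := Finset.exists_max_image _ id hne
  refine ⟨j, (Finset.mem_filter.mp hj).2, ?_⟩
  by_contra! hlt
  induction j using Fin.lastCases with
  | cast i =>
    have h1 : before c i.succ ≤ p := by
      refine le_trans (le_of_eq ?_) hlt
      have : Finset.Iio i.succ = insert i.castSucc (Finset.Iio i.castSucc) := by
        ext x
        simp only [Finset.mem_insert, Finset.mem_Iio, Fin.lt_def, Fin.ext_iff, Fin.val_succ,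
          Fin.val_castSucc]
        omega
      rw [before, this, Finset.sum_insert (by simp), add_comm]
      rfl
    have := hmax i.succ (by simpa using h1)
    simp [Fin.le_def] at this
  | last =>
    have : (node c).leaves = before c (Fin.last m) + (c (Fin.last m)).leaves := by
      have h : (Finset.univ : Finset (Fin (m + 1))) =
          insert (Fin.last m) (Finset.Iio (Fin.last m)) := by
        ext x
        rw [Finset.mem_insert, Finset.mem_Iio, ← le_iff_eq_or_lt]
        simp [Fin.le_last]
      rw [leaves, h, Finset.sum_insert (by simp), add_comm]
      rfl
    omega

theorem graft_congr {g g' : ℕ → MTree m} (t : MTree m) {k : ℕ}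
    (h : ∀ n, k ≤ n → n < k + t.leaves → g n = g' n) : graft g t k = graft g' t k := by
  induction t generalizing k with
  | leaf => exact h k le_rfl (by simp [leaves])
  | node c ih =>
    rw [graft, graft]
    congr 1
    funext j
    refine ih j fun n h1 h2 => h n (by omega) ?_
    have := before_add_leaves_le_leaves c j
    omega

theorem graft_eq_self {g : ℕ → MTree m} (t : MTree m) {k : ℕ}
    (h : ∀ n, k ≤ n → n < k + t.leaves → g n = leaf) : graft g t k = t := by
  rw [graft_congr t h, graft_leaf]

theorem start_eq_self {F : ℕ → MTree m} {n : ℕ} (h : ∀ r, r < n → F r = leaf) :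
    start F n = n := by
  refine Eq.trans (Finset.sum_congr rfl fun r hr => ?_) (start_leaf (m := m) n)
  rw [h r (Finset.mem_range.mp hr)]

theorem start_mono (F : ℕ → MTree m) {a b : ℕ} (h : a ≤ b) : start F a ≤ start F b :=
  Finset.sum_le_sum_of_subset (Finset.range_mono h)

theorem start_succ (F : ℕ → MTree m) (n : ℕ) : start F (n + 1) = start F n + (F n).leaves :=
  Finset.sum_range_succ _ _

theorem exists_start_le_lt (F : ℕ → MTree m) (i : ℕ) :
    ∃ r, start F r ≤ i ∧ i < start F r + (F r).leaves := by
  have h : ∃ n, i < start F n := ⟨i + 1, Nat.lt_of_lt_of_le (Nat.lt_succ_self i) (le_start F _)⟩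
  classical
  have h1 := Nat.find_spec h
  obtain ⟨r, hr⟩ : ∃ r, Nat.find h = r + 1 := by
    refine Nat.exists_eq_succ_of_ne_zero fun h0 => ?_
    rw [h0] at h1
    simp [start] at h1
  refine ⟨r, not_lt.mp (Nat.find_min h (by omega)), ?_⟩
  rwa [hr, start_succ] at h1

end MTree

/-! ### Trimming as right division by a one-node forest -/

namespace IndexedForest

variable {m : ℕ}

theorem single_tree (i n : ℕ) :
    (single m i).tree n = if n = i then node fun _ => leaf else leaf :=
  Function.update_apply (fun _ => leaf) i _ n

theorem mul_tree (F G : IndexedForest m) (r : ℕ) :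
    (F * G).tree r = graft G.tree (F.tree r) (start F.tree r) := rfl

theorem one_tree (r : ℕ) : (1 : IndexedForest m).tree r = leaf := rfl

theorem graft_single_eq_self (t : MTree m) {k i : ℕ} (h : i < k ∨ k + t.leaves ≤ i) :
    graft (single m i).tree t k = t := by
  refine graft_eq_self t fun n h1 h2 => ?_
  rw [single_tree, if_neg (by omega)]

/-- The label belongs to the j-th child, so the other children receive only trivial trees. -/
theorem graft_single_update (c : Fin (m + 1) → MTree m) (j : Fin (m + 1)) (k i : ℕ)
    (h : i < (c j).leaves) :
    graft (single m (k + (before c j + i))).tree (node c) k =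
      node (Function.update c j
        (graft (single m (k + before c j + i)).tree (c j) (k + before c j))) := by
  rw [graft]
  congr 1
  funext x
  rcases lt_trichotomy x j with hx | rfl | hx
  · rw [Function.update_of_ne hx.ne]
    have := before_add_leaves_le c hx
    exact graft_single_eq_self _ (by omega)
  · rw [Function.update_self, add_assoc]
  · rw [Function.update_of_ne hx.ne']
    have := before_add_leaves_le c hx
    exact graft_single_eq_self _ (by omega)

theorem eq_graft_of_trims {t t' : MTree m} {p : ℕ} (h : MTree.Trims t' p t) :
    p < t.leaves ∧ ∀ k, t' = graft (single m (k + p)).tree t k := by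
  induction h with
  | root => exact ⟨by simp [leaves], fun k => by rw [graft, single_tree, add_zero, if_pos rfl]⟩
  | child c j i t _ ih =>
    -- Trimming inside child j does not alter the leaf count to its left.
    have hb := before_update c (le_refl j) t
    constructor
    · have := before_add_leaves_le_leaves (Function.update c j t) j
      rw [hb, Function.update_self] at this
      omega
    · intro k
      rw [← hb, graft_single_update _ _ _ _ (by rw [Function.update_self]; exact ih.1),
        Function.update_self, ← ih.2, Function.update_idem, Function.update_eq_self]

theorem trims_graft (t : MTree m) {p : ℕ} (hp : p < t.leaves) (k : ℕ) :
    MTree.Trims (graft (single m (k + p)).tree t k) p t := by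
  induction t generalizing p k with
  | leaf =>
    have : p = 0 := by simpa [leaves] using hp
    subst this
    rw [graft, single_tree, if_pos (add_zero k).symm]
    exact MTree.Trims.root
  | node c ih =>
    obtain ⟨j, h1, h2⟩ := exists_before_le_lt c hp
    obtain ⟨i, rfl⟩ := Nat.exists_eq_add_of_le h1
    have hi : i < (c j).leaves := by omega
    rw [graft_single_update _ _ _ _ hi]
    have h := MTree.Trims.child (Function.update c j
      (graft (single m (k + before c j + i)).tree (c j) (k + before c j))) j i (c j) (by
        rw [Function.update_self]
        exact ih j hi _)
    rwa [before_update _ le_rfl, Function.update_idem, Function.update_eq_self] at h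

theorem tree_mul_single (F : IndexedForest m) (r p : ℕ) (hp : p < (F.tree r).leaves) :
    (F * single m (start F.tree r + p)).tree = Function.update F.tree r
      (graft (single m (start F.tree r + p)).tree (F.tree r) (start F.tree r)) := by
  funext x
  rw [mul_tree]
  rcases lt_trichotomy x r with hx | rfl | hx
  · rw [Function.update_of_ne hx.ne]
    have := start_mono F.tree (Nat.succ_le_of_lt hx)
    rw [Nat.succ_eq_add_one, start_succ] at this
    exact graft_single_eq_self _ (by omega)
  · rw [Function.update_self]
  · rw [Function.update_of_ne hx.ne']
    have := start_mono F.tree (Nat.succ_le_of_lt hx)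
    rw [Nat.succ_eq_add_one, start_succ] at this
    exact graft_single_eq_self _ (by omega)

theorem start_update (F : ℕ → MTree m) (r : ℕ) (t : MTree m) :
    start (Function.update F r t) r = start F r := by
  refine Finset.sum_congr rfl fun x hx => ?_
  rw [Function.update_of_ne (Finset.mem_range.mp hx).ne]

/-- Trimming is the inverse of right multiplication by a forest of size one. -/
theorem trims_iff {F F' : IndexedForest m} {i : ℕ} : Trims F i F' ↔ F = F' * single m i := by
  constructor
  · rintro ⟨r, k, t, h, rfl, hF'⟩
    obtain ⟨hk, h⟩ := eq_graft_of_trims h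
    have ht : F'.tree r = t := by rw [hF', Function.update_self]
    have hs : start F.tree r = start F'.tree r := by rw [hF', start_update]
    apply IndexedForest.ext
    rw [hs, tree_mul_single F' r k (by rwa [ht]), ht, ← h, hF', Function.update_idem,
      Function.update_eq_self]
  · rintro rfl
    obtain ⟨r, h1, h2⟩ := exists_start_le_lt F'.tree i
    obtain ⟨p, rfl⟩ := Nat.exists_eq_add_of_le h1
    have hp : p < (F'.tree r).leaves := by omega
    refine ⟨r, p, F'.tree r, trims_graft (F'.tree r) hp _, ?_, ?_⟩
    · rw [tree_mul_single F' r p hp, start_update]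
    · rw [tree_mul_single F' r p hp, Function.update_idem, Function.update_eq_self]

theorem trimSeq_iff {F : IndexedForest m} {l : List ℕ} :
    TrimSeq F l ↔ (l.map (single m)).prod = F := by
  constructor
  · intro h
    induction h with
    | nil => rfl
    | snoc F F' i l h _ ih => rw [trims_iff.mp h, List.map_append, List.prod_append, ih]; simp
  · rintro rfl
    induction l using List.reverseRecOn with
    | nil => exact TrimSeq.nil
    | append_singleton l i ih => exact TrimSeq.snoc _ _ _ _ (trims_iff.mpr (by simp)) ih

/-! ### Left multiplication by a forest of size one -/

theorem start_single (i r : ℕ) :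
    start (single m i).tree r = if r ≤ i then r else r + m := by
  induction r with
  | zero => simp [start]
  | succ r ih =>
    rw [start_succ, ih, single_tree]
    split_ifs <;> simp [leaves] <;> omega

theorem single_mul_tree_of_lt (G : IndexedForest m) {i r : ℕ} (h : r < i) :
    (single m i * G).tree r = G.tree r := by
  rw [mul_tree, start_single, single_tree, if_neg h.ne, if_pos h.le, graft]

theorem single_mul_tree_self (G : IndexedForest m) (i : ℕ) :
    (single m i * G).tree i = node fun j => G.tree (i + j) := by
  rw [mul_tree, start_single, single_tree, if_pos rfl, if_pos le_rfl, graft]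
  congr 1
  funext j
  simp [graft, before, leaves]

theorem single_mul_tree_of_gt (G : IndexedForest m) {i r : ℕ} (h : i < r) :
    (single m i * G).tree r = G.tree (r + m) := by
  rw [mul_tree, start_single, single_tree, if_neg h.ne', if_neg (by omega), graft]

/-- Every tree of G is visible in the product: m + 1 of them as children of the new root, the others
as whole trees. -/
theorem single_mul_left_cancel {G G' : IndexedForest m} {i : ℕ}
    (h : single m i * G = single m i * G') : G = G' := by
  apply IndexedForest.ext
  funext r
  by_cases h1 : r < i
  · rw [← single_mul_tree_of_lt G h1, h, single_mul_tree_of_lt G' h1]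
  · by_cases h2 : r ≤ i + m
    · have := single_mul_tree_self G i
      rw [h, single_mul_tree_self, node.injEq] at this
      have := congrFun this ⟨r - i, by omega⟩
      simp only [show i + (r - i) = r by omega] at this
      exact this.symm
    · obtain ⟨s, rfl⟩ : ∃ s, r = s + m := ⟨r - m, by omega⟩
      rw [← single_mul_tree_of_gt G (by omega : i < s), h, single_mul_tree_of_gt G' (by omega)]

theorem single_mul_single {i j : ℕ} (h : j < i) :
    single m i * single m j = single m j * single m (i + m) := by
  apply IndexedForest.ext
  funext r
  rcases lt_trichotomy r j with hr | rfl | hr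
  · rw [single_mul_tree_of_lt _ (by omega), single_mul_tree_of_lt _ hr, single_tree, single_tree,
      if_neg (by omega), if_neg (by omega)]
  · rw [single_mul_tree_of_lt _ h, single_mul_tree_self, single_tree, if_pos rfl]
    congr 1
    funext x
    have := x.2
    rw [single_tree, if_neg (by omega)]
  · rw [single_mul_tree_of_gt _ hr, single_tree]
    rcases lt_trichotomy r i with hr' | rfl | hr'
    · rw [single_mul_tree_of_lt _ hr', single_tree, if_neg (by omega), if_neg (by omega)]
    · rw [single_mul_tree_self, if_pos rfl]
      congr 1
      funext x
      rw [single_tree, if_neg (by omega)]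
    · rw [single_mul_tree_of_gt _ hr', single_tree, if_neg (by omega), if_neg (by omega)]

theorem prod_tree_of_lt (l : List ℕ) {r : ℕ} (h : ∀ i ∈ l, r < i) :
    (l.map (single m)).prod.tree r = leaf := by
  induction l with
  | nil => rfl
  | cons i l ih =>
    rw [List.map_cons, List.prod_cons, single_mul_tree_of_lt _ (h i List.mem_cons_self)]
    exact ih fun j hj => h j (List.mem_cons_of_mem _ hj)

/-- A first letter i makes tree i nontrivial, while letters all larger than i leave it trivial. -/
theorem le_of_prod_cons_eq {l l' : List ℕ} {i j : ℕ} (hl : ∀ x ∈ l', j ≤ x)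
    (h : ((i :: l).map (single m)).prod = ((j :: l').map (single m)).prod) : j ≤ i := by
  by_contra! hlt
  have h1 := prod_tree_of_lt (m := m) (j :: l') (r := i) (by
    intro x hx
    rcases List.mem_cons.mp hx with rfl | hx
    · exact hlt
    · exact hlt.trans_le (hl x hx))
  rw [← h, List.map_cons, List.prod_cons, single_mul_tree_self] at h1
  cases h1

theorem cons_prod_ne_one (i : ℕ) (l : List ℕ) : ((i :: l).map (single m)).prod ≠ 1 := by
  intro h
  have := congrArg (fun F => IndexedForest.tree F i) h
  simp only [List.map_cons, List.prod_cons, single_mul_tree_self, one_tree] at this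
  cases this

/-- The forest determines the first letter of a sorted word, which is then cancelled on the left. -/
theorem eq_of_sorted_of_prod_eq {l l' : List ℕ} (hl : l.Pairwise (· ≤ ·))
    (hl' : l'.Pairwise (· ≤ ·)) (h : (l.map (single m)).prod = (l'.map (single m)).prod) :
    l = l' := by
  induction l generalizing l' with
  | nil =>
    cases l' with
    | nil => rfl
    | cons j l' => exact absurd h.symm (cons_prod_ne_one j l')
  | cons i l ih =>
    cases l' with
    | nil => exact absurd h (cons_prod_ne_one i l)
    | cons j l' =>
      rw [List.pairwise_cons] at hl hl'
      obtain rfl : i = j := le_antisymm (le_of_prod_cons_eq hl.1 h.symm)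
        (le_of_prod_cons_eq hl'.1 h)
      rw [List.map_cons, List.prod_cons, List.map_cons, List.prod_cons] at h
      rw [ih hl.2 hl'.2 (single_mul_left_cancel h)]

/-! ### Generation by the forests of size one -/

/-- The forest whose only nontrivial tree is `t`, at position `r`. -/
def treeAt (r : ℕ) (t : MTree m) : IndexedForest m where
  tree := Function.update (fun _ => leaf) r t
  finite := (Set.finite_singleton r).subset fun s hs => by
    by_contra h
    exact hs (Function.update_of_ne h _ _)

theorem treeAt_tree (r : ℕ) (t : MTree m) (s : ℕ) :
    (treeAt r t).tree s = if s = r then t else leaf :=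
  Function.update_apply (fun _ => leaf) r _ s

theorem mem_of_treeAt_mem (M : Submonoid (IndexedForest m)) (F : IndexedForest m)
    (h : ∀ r s, treeAt s (F.tree r) ∈ M) : F ∈ M := by
  obtain ⟨N, hN⟩ := F.finite.bddAbove
  have hN' : ∀ r, N + 1 ≤ r → F.tree r = leaf := fun r hr => by
    by_contra h
    have := hN h
    omega
  clear hN
  -- The induction is on the width d of a window starting at n outside which all trees are trivial.
  suffices ∀ (d n : ℕ) (F : IndexedForest m), (∀ r s, treeAt s (F.tree r) ∈ M) →
      (∀ r, r < n → F.tree r = leaf) → (∀ r, n + d ≤ r → F.tree r = leaf) → F ∈ M from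
    this (N + 1) 0 F h (by simp) (by simpa using hN')
  intro d
  induction d with
  | zero =>
    intro n F _ h1 h2
    have : F = 1 := IndexedForest.ext <| funext fun r => by
      rcases lt_or_ge r n with hr | hr
      · exact h1 r hr
      · exact h2 r hr
    rw [this]
    exact M.one_mem
  | succ d ih =>
    intro n F h h1 h2
    let F' : IndexedForest m := ⟨Function.update F.tree n leaf, F.finite.subset fun r hr => by
      by_contra hF
      simp only [Set.mem_ofPred_eq, not_not] at hF
      apply hr
      rw [Function.update_apply]
      split_ifs
      · rfl
      · exact hF⟩
    have hF' : ∀ r, F'.tree r = if r = n then leaf else F.tree r := fun r =>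
      Function.update_apply _ _ _ _
    have hs : ∀ r, r ≤ n → F'.tree r = leaf := by
      intro r hr
      rw [hF']
      split_ifs
      · rfl
      · exact h1 r (by omega)
    -- The trees of F' up to n are trivial, so its leaf n is root n, where the right factor plants
    -- the removed tree.
    have : F = F' * treeAt n (F.tree n) := by
      apply IndexedForest.ext
      funext r
      rw [mul_tree]
      rcases lt_trichotomy r n with hr | rfl | hr
      · rw [hs r hr.le, start_eq_self fun x hx => hs x (by omega), graft, treeAt_tree, if_neg hr.ne,
          h1 r hr]
      · rw [hs r le_rfl, start_eq_self fun x hx => hs x (by omega), graft, treeAt_tree, if_pos rfl]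
      · rw [graft_eq_self, hF', if_neg hr.ne']
        intro k hk _
        have := le_start F'.tree r
        rw [treeAt_tree, if_neg (by omega)]
    rw [this]
    refine M.mul_mem (ih (n + 1) F' ?_ (fun r hr => hs r (by omega)) ?_) (h n n)
    · intro r s
      rw [hF']
      split_ifs
      · have : treeAt s (leaf : MTree m) = 1 := IndexedForest.ext <| funext fun x => by
          rw [treeAt_tree, ite_self, one_tree]
        rw [this]
        exact M.one_mem
      · exact h r s
    · intro r hr
      rw [hF', if_neg (by omega)]
      exact h2 r (by omega)

theorem mem_of_single_mem (M : Submonoid (IndexedForest m)) (h : ∀ i, single m i ∈ M)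
    (F : IndexedForest m) : F ∈ M := by
  suffices ∀ (t : MTree m) (s : ℕ), treeAt s t ∈ M from mem_of_treeAt_mem M F fun r s => this _ s
  have hleaf : ∀ s, treeAt s (leaf : MTree m) ∈ M := fun s => by
    have : treeAt s (leaf : MTree m) = 1 := IndexedForest.ext <| funext fun x => by
      rw [treeAt_tree, ite_self, one_tree]
    rw [this]
    exact M.one_mem
  intro t
  induction t with
  | leaf => exact hleaf
  | node c ih =>
    intro s
    -- The children of the root, planted at positions s to s + m: one node at s joins them to the
    -- original tree.
    let G : IndexedForest m :=
      { tree := fun r => if h : s ≤ r ∧ r - s < m + 1 then c ⟨r - s, h.2⟩ else leaf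
        finite := (Set.finite_Iio (s + m + 1)).subset fun r hr => by
          by_contra hlt
          apply hr
          rw [Set.mem_Iio] at hlt
          exact dif_neg (by omega) }
    have hG : ∀ r, G.tree r = if h : s ≤ r ∧ r - s < m + 1 then c ⟨r - s, h.2⟩ else leaf :=
      fun _ => rfl
    have : treeAt s (node c) = single m s * G := by
      apply IndexedForest.ext
      funext r
      rw [treeAt_tree]
      rcases lt_trichotomy r s with hr | rfl | hr
      · rw [if_neg hr.ne, single_mul_tree_of_lt _ hr, hG, dif_neg (by omega)]
      · rw [if_pos rfl, single_mul_tree_self]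
        congr 1
        funext j
        have := j.2
        rw [hG, dif_pos (by omega)]
        congr 1
        ext
        simp
      · rw [if_neg hr.ne', single_mul_tree_of_gt _ hr, hG, dif_neg (by omega)]
    rw [this]
    refine M.mul_mem (h s) (mem_of_treeAt_mem M G fun r x => ?_)
    rw [hG]
    split_ifs
    · exact ih _ x
    · exact hleaf x

end IndexedForest

/-! ### The isomorphism and the theorem -/

open IndexedForest

/-- The map from the Thompson monoid to the forests. -/
def thompsonToForest (m : ℕ) : Thompson m →* IndexedForest m :=
  Thompson.lift (single m) fun _ _ h => single_mul_single h

theorem thompsonToForest_word {m : ℕ} (l : List ℕ) :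
    thompsonToForest m (Thompson.word m l) = (l.map (single m)).prod :=
  Thompson.map_word _ l

theorem thompsonToForest_bijective (m : ℕ) : Function.Bijective (thompsonToForest m) := by
  constructor
  · intro u v h
    obtain ⟨l, hl, rfl⟩ := Thompson.exists_sorted_word u
    obtain ⟨l', hl', rfl⟩ := Thompson.exists_sorted_word v
    rw [thompsonToForest_word, thompsonToForest_word] at h
    rw [eq_of_sorted_of_prod_eq hl hl' h]
  · intro F
    exact MonoidHom.mem_mrange.mp
      (mem_of_single_mem (MonoidHom.mrange (thompsonToForest m)) (fun i => ⟨Thompson.gen m i, rfl⟩) F)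

/-- The isomorphism between the Thompson monoid and the forests. -/
def thompsonEquivForest (m : ℕ) : Thompson m ≃* IndexedForest m :=
  MulEquiv.ofBijective (thompsonToForest m) (thompsonToForest_bijective m)

theorem trimSeq_thompsonEquivForest {m : ℕ} (w : Thompson m) (l : List ℕ) :
    TrimSeq (thompsonEquivForest m w) l ↔ Thompson.word m l = w := by
  rw [trimSeq_iff, ← thompsonToForest_word]
  exact (thompsonToForest_bijective m).1.eq_iff

end MForest

end

theorem mainTheorem11 (m : ℕ) [NeZero m] :
    (∀ i, MForest.shiftOp (MForest.qdd m 0) i = MForest.qdd m i) ∧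
    MForest.IsCreation (MForest.qdd m 0) (MForest.creator m) ∧
    MForest.IsDDPair (MForest.qdd m 0) (MForest.Thompson.gen m) ∧
    ∃ e : MForest.Thompson m ≃* MForest.IndexedForest m,
      (∀ i, e (MForest.Thompson.gen m i) = MForest.IndexedForest.single m i) ∧
      ∃ S : MForest.IndexedForest m → MForest.Poly,
        MForest.IsDualFamily (MForest.qdd m 0) (MForest.Thompson.gen m) (fun w => S (e w)) ∧
        (∀ S' : MForest.IndexedForest m → MForest.Poly,
          MForest.IsDualFamily (MForest.qdd m 0) (MForest.Thompson.gen m) (fun w => S' (e w)) →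
            S' = S) ∧
        (∀ F, {l | MForest.IndexedForest.TrimSeq F l}.Finite ∧
          S F = ∑ᶠ l ∈ {l | MForest.IndexedForest.TrimSeq F l}, MForest.creatorWord m l) ∧
        (∀ l s, 0 ≤ (MForest.creatorWord m l).coeff s) ∧
        (∀ F s, 0 ≤ (S F).coeff s) := by
  open MForest in
  let e := thompsonEquivForest m
  have hset : ∀ w, {l | IndexedForest.TrimSeq (e w) l} = {l | Thompson.word m l = w} := fun w =>
    Set.ext (trimSeq_thompsonEquivForest w)
  have hfin : ∀ F, {l | IndexedForest.TrimSeq (m := m) F l}.Finite := fun F => by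
    rw [← e.apply_symm_apply F, hset]
    exact Thompson.finite_words _
  -- The trimming formula serves as the definition; duality is carried over from `dualQuot`, since
  -- trimming sequences are words.
  let S : IndexedForest m → Poly := fun F =>
    ∑ᶠ l ∈ {l | IndexedForest.TrimSeq F l}, creatorWord m l
  have hS : (fun w => S (e w)) = fun w => Thompson.dualQuot w [] := by
    funext w
    simp only [S, hset, Thompson.dualQuot, List.append_nil]
  have hdual : IsDualFamily (qdd m 0) (Thompson.gen m) fun w => S (e w) := by
    rw [hS]
    exact Thompson.isDualFamily_dualQuot
  refine ⟨shiftOp_qdd m, isCreation m, isDDPair m, e, fun _ => rfl, S, hdual, fun S' h => ?_,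
    fun F => ⟨hfin F, rfl⟩, creatorWord_mem_nonnegPoly m, fun F => ?_⟩
  · funext F
    have := Thompson.eq_of_isDualFamily h hdual (e.symm F)
    simpa only [e.apply_symm_apply] using this
  · change S F ∈ nonnegPoly
    exact finsum_mem_induction (· ∈ nonnegPoly) nonnegPoly.zero_mem
      (fun _ _ => nonnegPoly.add_mem) fun l _ => creatorWord_mem_nonnegPoly m l
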